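/- Let $k$ be a field, $S=k[x_1,\dots,x_n]$ with the standard grading, $0\le t\le n-3$, and $c,d\in\mathbb Z$. For a graded module $M$ let $M(d)_i=M_{d+i}$. Let $(K_\bullet,\partial_\bullet)$ be the Koszul complex of $x_1,\dots,x_n$ over $S$: $K_j$ is free with basis $e_J$ ($J\subset[n]=\{1,\dots,n\}$, $|J|=j$), $\deg e_J=j$, and $\partial_j(e_J)=\sum_{i\in J}(-1)^{\#\{l\in J\,:\,l<i\}}x_i\,e_{J\setminus\{i\}}$. For $j\ge 1$ let $E_j=\operatorname{Im}\partial_j\subset K_{j-1}$, the $j$-th syzygy module of $k$ ($E_j=0$ for $j>n$). Let $e_J^*$ be the dual basis of $\operatorname{Hom}_S(K_j,S)$, and for disjoint $J,L\subset[n]$ put $\sigma(J,L)=(-1)^{\#\{(j,l)\in J\times L\,:\,j>l\}}$. Let $\mathcal A\subset \operatorname{Hom}_S(K_{t+1},S)$ and $\mathcal B\subset\operatorname{Hom}_S(K_{n-1},S)$ be the $S$-submodules $$\mathcal A=\Big\langle \sum_{j=1}^{n-t}(-1)^{j+1}\sigma\big(L\setminus\{i_j\},([n]\setminus L)\cup\{i_j\}\big)\,x_{i_j}e^*_{([n]\setminus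 L)\cup\{i_j\}} \;\Big|\; L=\{i_1<\dots<i_{n-t}\}\subset[n]\Big\rangle,$$ $$\mathcal B=\Big\langle (-1)^i x_j e^*_{[n]\setminus\{i\}}-(-1)^j x_i e^*_{[n]\setminus\{j\}} \;\Big|\; 1\le i<j\le n\Big\rangle .$$ For an ideal $I\subset S$, integers $p,q\ge 0$ and $a_1,\dots,a_p,b_1,\dots,b_q\in\mathbb Z$ consider the following. (i) $I$ is a graded ideal, and there is an exact sequence (a long Bourbaki sequence) of graded modules and homomorphisms of degree $0$ $$0\to\bigoplus_{i=1}^pS(-a_i)\to\bigoplus_{i=1}^qS(-b_i)\xrightarrow{\ g\ }E_{t+1}\oplus E_{n-1}(d)\to I(c)\to 0 .$$ (ii) There are homogeneous elements $\beta_1,\dots,\beta_q$ of $K_{t+1}\oplus K_{n-1}(d)$, of degrees $b_1,\dots,b_q$, none of them in $E_{t+2}\oplus E_n(d)$, and a map $\varphi=(\alpha,\gamma)$ with $\alpha\in\mathcal A$, $\gamma\in\mathcal B$, such that (a) $\varphi:K_{t+1}\oplus K_{n-1}(d)\to S(-n)$ is homogeneous of degree $n+c$, and $\operatorname{Ker}\varphi=\langle\beta_1,\dots,\beta_q\rangle+E_{t+2}\oplus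 E_n(d)$; (b) $p=q-n+2-\binom{n-1}{t}$, and for the map $\beta:\bigoplus_{i=1}^qS(-b_i)\to K_{t+1}\oplus K_{n-1}(d)$, $g_i\mapsto\beta_i$ ($g_1,\dots,g_q$ the standard basis), there is an injective homomorphism of degree $0$, $f:\bigoplus_{i=1}^pS(-a_i)\to\bigoplus_{i=1}^qS(-b_i)$, such that $\operatorname{Res}(\beta):=\beta\circ f$ has image $\langle\beta_1,\dots,\beta_q\rangle\cap(E_{t+2}\oplus E_n(d))$ and $f$ maps $\operatorname{Ker}\operatorname{Res}(\beta)$ isomorphically onto $\operatorname{Ker}\beta$; that is, there is a commutative diagram with exact rows and columns $$\begin{array}{ccccccc} &&0&&0&&\\ &&\downarrow&&\downarrow&&\\ 0&\to&\operatorname{Ker}\operatorname{Res}(\beta)&\to&\operatorname{Ker}\beta&\to&0\\ &&\downarrow&&\downarrow&&\\ 0&\to&\bigoplus_{i=1}^pS(-a_i)&\to&\bigoplus_{i=1}^qS(-b_i)&&\\ &&\downarrow{\scriptstyle \operatorname{Res}(\beta)}&&\downarrow{\scriptstyle\beta}&&\\ 0&\to&\langle\beta_1,\dots,\beta_q\rangle\cap(E_{t+2}\oplus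 E_n(d))&\to&\langle\beta_1,\dots,\beta_q\rangle&&\\ &&\downarrow&&\downarrow&&\\ &&0&&0&& \end{array}$$ (c) $I=\varphi(K_{t+1}\oplus K_{n-1}(d))(-c)$. **Theorem.** For every ideal $I\subset S$: there are $p,q,a_i,b_i$ for which (i) holds if and only if there are $p,q,a_i,b_i$ for which (ii) holds. Moreover, for every $I$ and all given $p,q,a_1,\dots,a_p,b_1,\dots,b_q$: a sequence as in (i) with $g(g_i)\neq 0$ for all $i=1,\dots,q$ exists if and only if (ii) holds. -/

import Mathlib

open MvPolynomial

namespace LongBourbaki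

/-- The polynomial ring `S = k[x_1, …, x_n]`; the variables are indexed by `Fin n`. -/
abbrev Poly (k : Type*) [Field k] (n : ℕ) : Type _ := MvPolynomial (Fin n) k

section Gradings

variable {k : Type*} [Field k] {n : ℕ}

/-- The homogeneous component `S_m`, `m ∈ ℤ`, of `S` for the standard grading (`S_m = 0` for
`m < 0`). -/
noncomputable def polyGrading (k : Type*) [Field k] (n : ℕ) (m : ℤ) : Submodule k (Poly k n) :=
  if 0 ≤ m then homogeneousSubmodule (Fin n) k m.toNat else ⊥

/-- The shift of a grading: `M(d)_m = M_{d + m}`. -/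
def shift {M : Type*} [AddCommGroup M] [Module k M] (G : ℤ → Submodule k M) (d : ℤ) :
    ℤ → Submodule k M :=
  fun m => G (d + m)

/-- The grading of the free module `⨁_i S(-w_i)`: its degree `m` part is `⨁_i S_{m - w_i}`. -/
noncomputable def freeGrading {ι : Type*} (w : ι → ℤ) (m : ℤ) : Submodule k (ι → Poly k n) :=
  Submodule.pi Set.univ fun i => shift (polyGrading k n) (-w i) m

/-- The grading which a submodule inherits: `N_m = N ∩ M_m`. -/
noncomputable def subGrading {M : Type*} [AddCommGroup M] [Module k M] [Module (Poly k n) M]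
    [IsScalarTower k (Poly k n) M] (N : Submodule (Poly k n) M) (G : ℤ → Submodule k M) (m : ℤ) :
    Submodule k N :=
  (G m).comap (N.subtype.restrictScalars k)

/-- The grading of a direct sum. -/
def prodGrading {M N : Type*} [AddCommGroup M] [Module k M] [AddCommGroup N] [Module k N]
    (G : ℤ → Submodule k M) (H : ℤ → Submodule k N) (m : ℤ) : Submodule k (M × N) :=
  (G m).prod (H m)

/-- `f` is homogeneous of degree `e`: it maps the degree `m` part into the degree `m + e` part. -/
def IsHomogeneousHom {M N : Type*} [AddCommGroup M] [Module k M] [Module (Poly k n) M]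
    [AddCommGroup N] [Module k N] [Module (Poly k n) N]
    (G : ℤ → Submodule k M) (H : ℤ → Submodule k N) (e : ℤ) (f : M →ₗ[Poly k n] N) : Prop :=
  ∀ m : ℤ, ∀ v ∈ G m, f v ∈ H (m + e)

end Gradings

section Koszul

/-- The module `K_j` of the Koszul complex of `x_1, …, x_n` over `S`: the free module with one
coordinate for each subset `J` of `{1, …, n}` with `j` elements. -/
abbrev Koszul (k : Type*) [Field k] (n j : ℕ) : Type _ :=
  {J : Finset (Fin n) // J.card = j} → Poly k n

variable (k : Type*) [Field k] {n : ℕ}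

/-- The basis element `e_J` of `K_j`, for a set `J` with `j` elements (`0` for other `J`). -/
noncomputable def kBasis (j : ℕ) (J : Finset (Fin n)) : Koszul k n j :=
  if h : J.card = j then Pi.single ⟨J, h⟩ 1 else 0

/-- The dual basis element `e_J^*` of `Hom_S(K_j, S)`, for a set `J` with `j` elements (`0` for
other `J`). -/
noncomputable def kDual (j : ℕ) (J : Finset (Fin n)) : Koszul k n j →ₗ[Poly k n] Poly k n :=
  if h : J.card = j then LinearMap.proj ⟨J, h⟩ else 0

/-- The differential `∂_j : K_j → K_{j-1}`,
`∂_j e_J = ∑_{i ∈ J} (-1)^{#{l ∈ J : l < i}} x_i e_{J \ {i}}`; it is zero for `j = 0`. -/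
noncomputable def koszulD (n j : ℕ) : Koszul k n j →ₗ[Poly k n] Koszul k n (j - 1) :=
  Fintype.linearCombination (Poly k n) fun J : {J : Finset (Fin n) // J.card = j} =>
    ∑ i ∈ J.1, ((-1 : Poly k n) ^ (J.1.filter (· < i)).card * X i) • kBasis k (j - 1) (J.1.erase i)

/-- The syzygy module `E_j` of the residue field, `j ≥ 1`, as the image of `∂_j` in `K_{j-1}`. -/
noncomputable def syz (n j : ℕ) : Submodule (Poly k n) (Koszul k n (j - 1)) :=
  LinearMap.range (koszulD k n j)

/-- The grading of `K_j`, in which each `e_J` has degree `j`: `K_j = S(-j)^(n choose j)`. -/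
noncomputable def koszulGrading (n j : ℕ) : ℤ → Submodule k (Koszul k n j) :=
  freeGrading fun _ => (j : ℤ)

/-- The grading of `E_j ⊆ K_{j-1}`. -/
noncomputable def syzGrading (n j : ℕ) : ℤ → Submodule k (syz k n j) :=
  subGrading (syz k n j) (koszulGrading k n (j - 1))

/-- `σ(J, L) = (-1)^i`, where `i` is the number of pairs `(j, l) ∈ J × L` with `j > l`. -/
def sigma (J L : Finset (Fin n)) : ℤ :=
  (-1) ^ ((J ×ˢ L).filter fun jl => jl.2 < jl.1).card

/-- The submodule `𝒜` of `Hom_S(K_{t+1}, S)` spanned by the elements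
`∑_j (-1)^(j+1) σ(L \ {i_j}, ([n] \ L) ∪ {i_j}) x_{i_j} e^*_{([n] \ L) ∪ {i_j}}`
for `L = {i_1 < … < i_{n-t}} ⊆ [n]`; the position `j` of `i = i_j` in `L` is `#{l ∈ L : l ≤ i}`. -/
noncomputable def spanA (n t : ℕ) :
    Submodule (Poly k n) (Koszul k n (t + 1) →ₗ[Poly k n] Poly k n) :=
  Submodule.span (Poly k n)
    {ψ | ∃ L : Finset (Fin n), L.card = n - t ∧
      ψ = ∑ i ∈ L,
        ((-1 : Poly k n) ^ ((L.filter (· ≤ i)).card + 1) *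
          ((sigma (L.erase i) (Lᶜ ∪ {i}) : ℤ) : Poly k n) * X i) • kDual k (t + 1) (Lᶜ ∪ {i})}

/-- The submodule `ℬ` of `Hom_S(K_{n-1}, S)` spanned by the elements
`(-1)^i x_j e^*_{[n] \ {i}} - (-1)^j x_i e^*_{[n] \ {j}}` for `1 ≤ i < j ≤ n`
(the index `i` in `Fin n` stands for the number `i + 1`). -/
noncomputable def spanB (n : ℕ) :
    Submodule (Poly k n) (Koszul k n (n - 1) →ₗ[Poly k n] Poly k n) :=
  Submodule.span (Poly k n)
    {ψ | ∃ i j : Fin n, i < j ∧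
      ψ = ((-1 : Poly k n) ^ ((i : ℕ) + 1) * X j) • kDual k (n - 1) (Finset.univ.erase i) -
        ((-1 : Poly k n) ^ ((j : ℕ) + 1) * X i) • kDual k (n - 1) (Finset.univ.erase j)}

/-- The module `K_{t+1} ⊕ K_{n-1}(d)`; the twist is recorded by `coverGrading`. -/
abbrev Cover (n t : ℕ) : Type _ := Koszul k n (t + 1) × Koszul k n (n - 1)

/-- The grading of `K_{t+1} ⊕ K_{n-1}(d)`. -/
noncomputable def coverGrading (n t : ℕ) (d : ℤ) : ℤ → Submodule k (Cover k n t) :=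
  prodGrading (koszulGrading k n (t + 1)) (shift (koszulGrading k n (n - 1)) d)

/-- The submodule `E_{t+2} ⊕ E_n(d)` of `K_{t+1} ⊕ K_{n-1}(d)`. -/
noncomputable def coverSyz (n t : ℕ) : Submodule (Poly k n) (Cover k n t) :=
  Submodule.prod (syz k n (t + 2)) (syz k n n)

/-- The module `E_{t+1} ⊕ E_{n-1}(d)`; the twist is recorded by `approxGrading`. -/
abbrev Approx (n t : ℕ) : Type _ := syz k n (t + 1) × syz k n (n - 1)

/-- The grading of `E_{t+1} ⊕ E_{n-1}(d)`. -/
noncomputable def approxGrading (n t : ℕ) (d : ℤ) : ℤ → Submodule k (Approx k n t) :=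
  prodGrading (syzGrading k n (t + 1)) (shift (syzGrading k n (n - 1)) d)

end Koszul

section Conditions

variable {k : Type*} [Field k] {n : ℕ}

/-- `I` is a graded ideal of `S` (for the standard grading). -/
def IsGradedIdeal (I : Ideal (Poly k n)) : Prop :=
  letI := MvPolynomial.gradedAlgebra (σ := Fin n) (R := k)
  I.IsHomogeneous (homogeneousSubmodule (Fin n) k)

/-- `I` is a graded ideal, and the maps `f, g, φ` form a long Bourbaki sequence, i.e. an exact
sequence of graded modules and homomorphisms of degree `0`
`0 → ⨁_{i ≤ p} S(-a_i) → ⨁_{i ≤ q} S(-b_i) → E_{t+1} ⊕ E_{n-1}(d) → I(c) → 0`. -/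
structure IsLongBourbaki (t : ℕ) (c d : ℤ) {p q : ℕ} (a : Fin p → ℤ) (b : Fin q → ℤ)
    (I : Ideal (Poly k n))
    (f : (Fin p → Poly k n) →ₗ[Poly k n] (Fin q → Poly k n))
    (g : (Fin q → Poly k n) →ₗ[Poly k n] Approx k n t)
    (φ : Approx k n t →ₗ[Poly k n] I) : Prop where
  graded_ideal : IsGradedIdeal I
  graded_f : IsHomogeneousHom (freeGrading a) (freeGrading b) 0 f
  graded_g : IsHomogeneousHom (freeGrading b) (approxGrading k n t d) 0 g
  graded_φ : IsHomogeneousHom (approxGrading k n t d)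
    (shift (subGrading I (polyGrading k n)) c) 0 φ
  injective_f : Function.Injective f
  exact_fg : Function.Exact f g
  exact_gφ : Function.Exact g φ
  surjective_φ : Function.Surjective φ

/-- The map `β : ⨁_{i ≤ q} S(-b_i) → K_{t+1} ⊕ K_{n-1}(d)` with `β(g_i) = β_i`, where
`g_1, …, g_q` is the standard basis. -/
noncomputable def betaMap {t q : ℕ} (β : Fin q → Cover k n t) :
    (Fin q → Poly k n) →ₗ[Poly k n] Cover k n t :=
  Fintype.linearCombination (Poly k n) β

/-- The kernel/restriction diagram: there is a graded injection `f` of `⨁_{i ≤ p} S(-a_i)` into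
`⨁_{i ≤ q} S(-b_i)`, along which `β` restricts to a map `Res(β) = β ∘ f` from
`⨁_{i ≤ p} S(-a_i)` onto `⟨β_1, …, β_q⟩ ∩ (E_{t+2} ⊕ E_n(d))`, and `f` induces an isomorphism of
`Ker Res(β)` with `Ker β`. (The column `0 → Ker β → ⨁ S(-b_i) → ⟨β_1, …, β_q⟩ → 0` is always
exact.) -/
def HasDiagram {t p q : ℕ} (a : Fin p → ℤ) (b : Fin q → ℤ) (β : Fin q → Cover k n t) : Prop :=
  ∃ f : (Fin p → Poly k n) →ₗ[Poly k n] (Fin q → Poly k n),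
    IsHomogeneousHom (k := k) (freeGrading a) (freeGrading b) 0 f ∧
    Function.Injective f ∧
    LinearMap.range (betaMap β ∘ₗ f) =
      Submodule.span (Poly k n) (Set.range β) ⊓ coverSyz k n t ∧
    (LinearMap.ker (betaMap β ∘ₗ f)).map f = LinearMap.ker (betaMap β)

/-- The conditions on `β_1, …, β_q` and on the map `φ : K_{t+1} ⊕ K_{n-1}(d) → S(-n)` in the
characterization of long Bourbaki sequences. -/
structure IsConstruction (t : ℕ) (c d : ℤ) {p q : ℕ} (a : Fin p → ℤ) (b : Fin q → ℤ)
    (β : Fin q → Cover k n t) (φ : Cover k n t →ₗ[Poly k n] Poly k n) : Prop where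
  /-- `β_i` is homogeneous of degree `b_i` in `K_{t+1} ⊕ K_{n-1}(d)`. -/
  homogeneous_β : ∀ i, β i ∈ coverGrading k n t d (b i)
  not_mem_β : ∀ i, β i ∉ coverSyz k n t
  /-- `φ = (α, γ)` with `α ∈ 𝒜` and `γ ∈ ℬ`. -/
  form_φ : ∃ α ∈ spanA k n t, ∃ γ ∈ spanB k n, φ = LinearMap.coprod α γ
  graded_φ : IsHomogeneousHom (coverGrading k n t d) (shift (polyGrading k n) (-(n : ℤ)))
    ((n : ℤ) + c) φ
  ker_φ : LinearMap.ker φ = Submodule.span (Poly k n) (Set.range β) ⊔ coverSyz k n t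
  numerical : (p : ℤ) = (q : ℤ) - (n : ℤ) + 2 - ((n - 1).choose t : ℤ)
  diagram : HasDiagram a b β

end Conditions

end LongBourbaki

/-! The Koszul differentials map $K_{t+1}\oplus K_{n-1}(d)$ onto $E_{t+1}\oplus E_{n-1}(d)$
(`coverMap`), with kernel $E_{t+2}\oplus E_n(d)$ because the Koszul complex is exact in positive
degrees (`mem_syz_iff`, `ker_coverMap`). Both right-hand maps of a long Bourbaki sequence can
therefore be read on this free cover. Homogeneous preimages of the $g(g_i)$ are the $\beta_i$, and
$\beta_i\notin E_{t+2}\oplus E_n(d)$ means $g(g_i)\ne 0$. The map onto $I(c)$ becomes a map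
$\varphi$ killing $E_{t+2}\oplus E_n(d)$, and exactness of the dual Koszul complex places its
components in $\mathcal A$ and $\mathcal B$ (`mem_spanA`, `mem_spanB`). Exactness at $E_{t+1}\oplus
E_{n-1}(d)$ is the formula for $\operatorname{Ker}\varphi$. Exactness at $\bigoplus S(-b_i)$ says
$\operatorname{Im} f=\beta^{-1}(E_{t+2}\oplus E_n(d))$, which is what the diagram expresses.
Conversely, the kernel formula alone lets $\varphi$ descend to $E_{t+1}\oplus E_{n-1}(d)$.

The value of $p$ is a rank count (`rank_relation`), which needs $I\ne 0$. If $I=0$, then $g$ is onto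
and $E_{t+1}\oplus E_{n-1}$ has projective dimension at most one; a Schanuel-type comparison then
makes $E_{t+2}$ projective, which minimality of the Koszul complex forbids since $t+2<n$
(`not_exact_of_surjective`).

A basis element with $g(g_i)=0$ equals $f(u)$ for a homogeneous $u$ having a unit coordinate, so one
summand cancels from each free module. Iterating this removes all such elements, at the price of
changing $p,q,a_i,b_i$. -/

namespace LongBourbaki

/-! ### The Koszul complex and its dual on the whole exterior algebra -/

section ExteriorComplex

variable {k : Type*} [Field k] {n : ℕ}

/-- The sign with which `e_M` occurs in `∂ e_{M ∪ {i}}`. -/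
noncomputable def koszulSign (k : Type*) [Field k] {n : ℕ} (i : Fin n) (M : Finset (Fin n)) :
    Poly k n :=
  (-1) ^ (M.filter (· < i)).card

theorem koszulSign_mul_self (i : Fin n) (M : Finset (Fin n)) :
    koszulSign k i M * koszulSign k i M = 1 := by
  rw [koszulSign, ← mul_pow]; simp

theorem koszulSign_eq_or (i : Fin n) (M : Finset (Fin n)) :
    koszulSign k i M = 1 ∨ koszulSign k i M = -1 :=
  neg_one_pow_eq_or _ _

theorem koszulSign_insert_of_lt {i j : Fin n} {M : Finset (Fin n)} (hj : j ∉ M) (h : j < i) :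
    koszulSign k i (insert j M) = -koszulSign k i M := by
  rw [koszulSign, koszulSign, Finset.filter_insert, if_pos h, Finset.card_insert_of_notMem, pow_succ]
  · ring
  · simp [hj]

theorem koszulSign_insert_of_le {i j : Fin n} (M : Finset (Fin n)) (h : i ≤ j) :
    koszulSign k i (insert j M) = koszulSign k i M := by
  rw [koszulSign, koszulSign, Finset.filter_insert, if_neg (not_lt.mpr h)]

theorem koszulSign_erase_self (i : Fin n) (M : Finset (Fin n)) :
    koszulSign k i (M.erase i) = koszulSign k i M := by
  by_cases h : i ∈ M
  · conv_rhs => rw [← Finset.insert_erase h]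
    rw [koszulSign_insert_of_le _ le_rfl]
  · rw [Finset.erase_eq_of_notMem h]

/-- Inserting the smaller of the two indices flips the sign of the larger, and not vice versa. This
is the anticommutativity behind $\partial^2=0$ and the homotopy formula. -/
theorem koszulSign_swap {i j : Fin n} {M : Finset (Fin n)} (hi : i ∉ M) (hj : j ∉ M) (h : i ≠ j) :
    koszulSign k i M * koszulSign k j (insert i M) =
      -(koszulSign k j M * koszulSign k i (insert j M)) := by
  rcases lt_or_gt_of_ne h with h | h
  · rw [koszulSign_insert_of_lt hi h, koszulSign_insert_of_le _ h.le]; ring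
  · rw [koszulSign_insert_of_lt hj h, koszulSign_insert_of_le _ h.le]; ring

/-- The Koszul differential on the whole exterior algebra, in coordinates. -/
noncomputable def extBoundary (k : Type*) [Field k] (n : ℕ) :
    (Finset (Fin n) → Poly k n) →ₗ[Poly k n] (Finset (Fin n) → Poly k n) :=
  LinearMap.pi fun M => ∑ i ∈ Mᶜ, (koszulSign k i M * X i) • LinearMap.proj (insert i M)

theorem extBoundary_apply (f : Finset (Fin n) → Poly k n) (M : Finset (Fin n)) :
    extBoundary k n f M = ∑ i ∈ Mᶜ, koszulSign k i M * X i * f (insert i M) := by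
  simp [extBoundary]

theorem extBoundary_extBoundary (f : Finset (Fin n) → Poly k n) :
    extBoundary k n (extBoundary k n f) = 0 := by
  funext M
  simp only [extBoundary_apply, Finset.mul_sum, Pi.zero_apply]
  rw [Finset.sum_sigma']
  refine Finset.sum_involution (fun x _ => ⟨x.2, x.1⟩) ?_ ?_ ?_ ?_
  · rintro ⟨i, j⟩ h
    simp only [Finset.mem_sigma, Finset.mem_compl, Finset.mem_insert, not_or] at h
    obtain ⟨hi, hji, hj⟩ := h
    have := koszulSign_swap (k := k) hi hj (Ne.symm hji)
    simp only
    rw [Finset.insert_comm i j]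
    linear_combination (X i * X j * f (insert j (insert i M))) * this
  · rintro ⟨i, j⟩ h _ h'
    simp only [Finset.mem_sigma, Finset.mem_compl, Finset.mem_insert, not_or] at h
    simp only [Sigma.mk.injEq] at h'
    exact h.2.1 h'.1
  · rintro ⟨i, j⟩ h
    simp only [Finset.mem_sigma, Finset.mem_compl, Finset.mem_insert, not_or] at h ⊢
    exact ⟨h.2.2, Ne.symm h.2.1, h.1⟩
  · rintro ⟨i, j⟩ _
    rfl

/-- Division by the variable `x_m`, dropping the monomials that are not divisible by `x_m`. -/
noncomputable def divX (k : Type*) [Field k] {n : ℕ} (m : Fin n) : Poly k n →+ Poly k n :=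
  AddMonoidHom.mk' (fun f => f.divMonomial (Finsupp.single m 1)) fun a b => add_divMonomial a b _

theorem divX_X_mul_self (m : Fin n) (f : Poly k n) : divX k m (X m * f) = f :=
  X_mul_divMonomial m f

theorem divX_X_mul_of_ne {m i : Fin n} (h : i ≠ m) (f : Poly k n) :
    divX k m (X i * f) = X i * divX k m f := by
  ext s
  change coeff s ((X i * f).divMonomial _) = coeff s (X i * f.divMonomial _)
  rw [coeff_divMonomial, coeff_X_mul', coeff_X_mul']
  have hs : i ∈ (Finsupp.single m 1 + s).support ↔ i ∈ s.support := by
    simp [h.symm]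
  simp only [hs]
  split_ifs with h1
  · rw [coeff_divMonomial]
    congr 1
    ext l
    simp only [Finsupp.coe_tsub, Finsupp.coe_add, Pi.sub_apply, Pi.add_apply]
    by_cases hl : l = i
    · subst hl
      simp [h.symm]
    · simp [Finsupp.single_apply, Ne.symm hl]
  · rfl

theorem divX_koszulSign_mul (m i : Fin n) (M : Finset (Fin n)) (f : Poly k n) :
    divX k m (koszulSign k i M * f) = koszulSign k i M * divX k m f := by
  rcases koszulSign_eq_or (k := k) i M with h | h <;> simp [h]

/-- The contracting homotopy belonging to the variable `x_m`. -/
noncomputable def extHomotopy (m : Fin n) (f : Finset (Fin n) → Poly k n)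
    (J : Finset (Fin n)) : Poly k n :=
  if m ∈ J then koszulSign k m J * divX k m (f (J.erase m)) else 0

/-- The homotopy vanishes on sets without $m$, so only the summand $i=m$ survives. -/
theorem extBoundary_extHomotopy_of_notMem {m : Fin n} {M : Finset (Fin n)} (hm : m ∉ M)
    (f : Finset (Fin n) → Poly k n) :
    extBoundary k n (extHomotopy m f) M = X m * divX k m (f M) := by
  rw [extBoundary_apply, Finset.sum_eq_single m]
  · rw [extHomotopy, if_pos (Finset.mem_insert_self _ _), Finset.erase_insert hm,
      koszulSign_insert_of_le _ le_rfl]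
    linear_combination (X m * divX k m (f M)) * koszulSign_mul_self (k := k) m M
  · intro i _ hi
    rw [extHomotopy, if_neg, mul_zero]
    simp [hm, hi.symm]
  · intro h
    simp [hm] at h

/-- The summand $i=m$ of the second term gives $f(M)$. The others cancel because division by $x_m$
commutes with $x_i$ for $i\ne m$ while the signs anticommute. -/
theorem extBoundary_extHomotopy_of_mem {m : Fin n} {M : Finset (Fin n)} (hm : m ∈ M)
    (f : Finset (Fin n) → Poly k n) :
    extBoundary k n (extHomotopy m f) M + extHomotopy m (extBoundary k n f) M = f M := by
  have hc : (M.erase m)ᶜ = insert m Mᶜ := by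
    ext l; simp only [Finset.mem_compl, Finset.mem_erase, Finset.mem_insert]; tauto
  have hm' : m ∉ Mᶜ := by simpa using hm
  rw [extBoundary_apply, extHomotopy, if_pos hm, extBoundary_apply, hc, Finset.sum_insert hm',
    map_add, map_sum, Finset.insert_erase hm, mul_assoc (koszulSign k m _), divX_koszulSign_mul,
    divX_X_mul_self, koszulSign_erase_self, mul_add, ← mul_assoc, koszulSign_mul_self, one_mul,
    add_left_comm, Finset.mul_sum, ← Finset.sum_add_distrib, Finset.sum_eq_zero, add_zero]
  intro i hi
  have hi : i ∉ M := by simpa using hi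
  have him : i ≠ m := fun h => hi (h ▸ hm)
  have hme : m ∉ M.erase m := by simp
  have hie : i ∉ M.erase m := by simp [hi]
  rw [extHomotopy, if_pos (Finset.mem_insert_of_mem hm), mul_assoc (koszulSign k i (M.erase m)),
    divX_koszulSign_mul, divX_X_mul_of_ne him, Finset.erase_insert_of_ne him]
  have h1 := koszulSign_swap (k := k) hie hme him
  rw [Finset.insert_erase hm, koszulSign_erase_self] at h1
  have h2 : koszulSign k m (insert i (M.erase m)) = koszulSign k m (insert i M) := by
    rw [← koszulSign_erase_self m (insert i M), Finset.erase_insert_of_ne him]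
  rw [h2] at h1
  have h3 := koszulSign_mul_self (k := k) m (insert i M)
  have h4 := koszulSign_mul_self (k := k) m M
  have h5 : koszulSign k i M * koszulSign k m (insert i M) +
      koszulSign k m M * koszulSign k i (M.erase m) = 0 := by
    linear_combination (koszulSign k m M * koszulSign k m (insert i M)) * h1 -
      koszulSign k m M * koszulSign k i (M.erase m) * h3 -
      koszulSign k i M * koszulSign k m (insert i M) * h4
  linear_combination (X i * divX k m (f (insert i (M.erase m)))) * h5

/-- The Koszul complex is exact away from the constants of its degree zero part. -/
theorem exists_extBoundary_eq (f : Finset (Fin n) → Poly k n) (hf : extBoundary k n f = 0)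
    (h0 : f ∅ = 0) : ∃ g, extBoundary k n g = f := by
  suffices H : ∀ A : Finset (Fin n), ∃ g, (∀ M, (∃ m ∈ A, m ∈ M) →
      f M = extBoundary k n g M) ∧ extBoundary k n g ∅ = 0 by
    obtain ⟨g, hg, hg0⟩ := H Finset.univ
    refine ⟨g, funext fun M => ?_⟩
    rcases M.eq_empty_or_nonempty with rfl | ⟨m, hm⟩
    · rw [hg0, h0]
    · exact (hg M ⟨m, Finset.mem_univ _, hm⟩).symm
  intro A
  induction A using Finset.induction_on with
  | empty => exact ⟨0, by simp, by simp⟩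
  | insert m A _ ih =>
    obtain ⟨g, hg, hg0⟩ := ih
    have hker : extBoundary k n (f - extBoundary k n g) = 0 := by
      rw [map_sub, hf, extBoundary_extBoundary, sub_zero]
    -- The correction repairs all $M\ni m$. On $M\not\ni m$ it adds $x_m$ times the quotient of
    -- $f-\partial g$ by $x_m$, which is zero where $f=\partial g$ already holds and also at
    -- $\emptyset$, so earlier progress is kept.
    refine ⟨g + extHomotopy m (f - extBoundary k n g), ?_, ?_⟩
    · rintro M ⟨l, hl, hlM⟩
      rw [map_add, Pi.add_apply]
      by_cases hm : m ∈ M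
      · have := extBoundary_extHomotopy_of_mem hm (f - extBoundary k n g)
        rw [hker] at this
        have h' : extHomotopy m (0 : Finset (Fin n) → Poly k n) M = 0 := by simp [extHomotopy]
        rw [h', add_zero] at this
        rw [this, Pi.sub_apply]; ring
      · have hlA : l ∈ A := (Finset.mem_insert.1 hl).resolve_left fun h => hm (h ▸ hlM)
        rw [extBoundary_extHomotopy_of_notMem hm, Pi.sub_apply, ← hg M ⟨l, hlA, hlM⟩]
        simp
    · rw [map_add, Pi.add_apply, extBoundary_extHomotopy_of_notMem (Finset.notMem_empty m),
        Pi.sub_apply, hg0, h0]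
      simp

/-- The Koszul complex of the dual is exact away from its top degree. -/
theorem exists_dual_extBoundary_eq (a : Finset (Fin n) → Poly k n)
    (ha : ∀ J, ∑ i ∈ J, koszulSign k i J * X i * a (J.erase i) = 0) (h0 : a Finset.univ = 0) :
    ∃ b : Finset (Fin n) → Poly k n,
      ∀ J, a J = ∑ i ∈ J, koszulSign k i J * X i * b (J.erase i) := by
  -- Self-duality of the Koszul complex: passing to complements with the sign $s$ turns the
  -- coboundary into the boundary.
  let s : Finset (Fin n) → Poly k n := fun M => ∏ i ∈ M, (-1) ^ (i : ℕ)
  have hs : ∀ M, s M * s M = 1 := fun M => by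
    simp only [s, ← Finset.prod_mul_distrib, ← mul_pow]; simp
  have hsi : ∀ {i M}, i ∉ M → s (insert i M) = (-1) ^ (i : ℕ) * s M :=
    fun h => Finset.prod_insert h
  -- Indices start at $0$, so exactly $i$ indices lie below $i$, and they are divided between $M$
  -- and its complement.
  have hsign : ∀ (i : Fin n) (M : Finset (Fin n)),
      koszulSign k i M * (-1) ^ (i : ℕ) = koszulSign k i Mᶜ := by
    intro i M
    have hc : (M.filter (· < i)).card + (Mᶜ.filter (· < i)).card = i := by
      rw [← Finset.card_union_of_disjoint, ← Finset.filter_union, Finset.union_compl]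
      · rw [show Finset.univ.filter (· < i) = Finset.Iio i by ext; simp, Fin.card_Iio]
      · exact Finset.disjoint_filter_filter disjoint_compl_right
    have : (-1 : Poly k n) ^ (i : ℕ) = koszulSign k i M * koszulSign k i Mᶜ := by
      rw [← hc, pow_add]; rfl
    rw [this, ← mul_assoc, koszulSign_mul_self, one_mul]
  have star : ∀ (b : Finset (Fin n) → Poly k n) (M : Finset (Fin n)),
      extBoundary k n (fun M => s M * b Mᶜ) M =
        s M * ∑ i ∈ Mᶜ, koszulSign k i Mᶜ * X i * b (Mᶜ.erase i) := by
    intro b M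
    rw [extBoundary_apply, Finset.mul_sum]
    refine Finset.sum_congr rfl fun i hi => ?_
    rw [Finset.mem_compl] at hi
    rw [hsi hi, ← hsign, Finset.compl_insert]
    ring
  obtain ⟨g, hg⟩ := exists_extBoundary_eq (fun M => s M * a Mᶜ)
    (funext fun M => by rw [star, ha, mul_zero]; rfl) (by simp [h0])
  refine ⟨fun M => s Mᶜ * g Mᶜ, fun J => ?_⟩
  have h1 := congrFun hg Jᶜ
  have h2 : g = fun M => s M * (fun M => s Mᶜ * g Mᶜ) Mᶜ := by
    funext M
    simp only [compl_compl, ← mul_assoc, hs, one_mul]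
  rw [h2, star (fun M => s Mᶜ * g Mᶜ)] at h1
  simp only [compl_compl] at h1
  have := congrArg (s Jᶜ * ·) h1
  simp only [← mul_assoc, hs, one_mul] at this
  rw [← this]
  simp only [mul_assoc]

end ExteriorComplex

/-! ### Exactness in each degree, and the modules $\mathcal A$ and $\mathcal B$ -/

section KoszulExactness

variable {k : Type*} [Field k] {n : ℕ}

theorem kBasis_apply {j : ℕ} (J : Finset (Fin n)) (M : {M : Finset (Fin n) // M.card = j}) :
    kBasis k j J M = if J = M.1 then 1 else 0 := by
  unfold kBasis
  split_ifs with h h' h'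
  · rw [Pi.single_apply, if_pos (Subtype.ext h'.symm)]
  · rw [Pi.single_apply, if_neg fun e => h' (by rw [e])]
  · exact absurd (h' ▸ M.2) h
  · rfl

theorem kBasis_of_card_ne {j : ℕ} {J : Finset (Fin n)} (h : J.card ≠ j) : kBasis k j J = 0 :=
  dif_neg h

theorem kDual_apply_single {j : ℕ} (J : Finset (Fin n)) (M : {M : Finset (Fin n) // M.card = j}) :
    kDual k j J (Pi.single M 1) = if J = M.1 then 1 else 0 := by
  unfold kDual
  split_ifs with h h' h'
  · rw [LinearMap.proj_apply, Pi.single_apply, if_pos (Subtype.ext h')]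
  · rw [LinearMap.proj_apply, Pi.single_apply, if_neg fun e => h' (by rw [← e])]
  · exact absurd (h' ▸ M.2) h
  · rfl

/-- Extension by zero of an element of `K_j` to the whole exterior algebra. -/
noncomputable def extendKoszul {j : ℕ} (v : Koszul k n j) (J : Finset (Fin n)) : Poly k n :=
  if h : J.card = j then v ⟨J, h⟩ else 0

theorem extBoundary_congr {j : ℕ} {f g : Finset (Fin n) → Poly k n}
    (h : ∀ J, J.card = j + 1 → f J = g J) {M : Finset (Fin n)} (hM : M.card = j) :
    extBoundary k n f M = extBoundary k n g M := by
  rw [extBoundary_apply, extBoundary_apply]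
  refine Finset.sum_congr rfl fun i hi => ?_
  rw [h _ (by rw [Finset.card_insert_of_notMem (Finset.mem_compl.1 hi), hM])]

theorem koszulD_single {j : ℕ} (J : {J : Finset (Fin n) // J.card = j}) :
    koszulD k n j (Pi.single J 1) =
      ∑ i ∈ J.1, (koszulSign k i J.1 * X i) • kBasis k (j - 1) (J.1.erase i) := by
  rw [koszulD, Fintype.linearCombination_apply_single, one_smul]
  rfl

theorem koszulD_apply {j : ℕ} (hj : 1 ≤ j) (v : Koszul k n j)
    (M : {M : Finset (Fin n) // M.card = j - 1}) :
    koszulD k n j v M = extBoundary k n (extendKoszul v) M.1 := by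
  have h1 : koszulD k n j v M = ∑ J : {J : Finset (Fin n) // J.card = j}, ∑ i : Fin n,
      if i ∈ J.1 ∧ J.1.erase i = M.1 then v J * (koszulSign k i J.1 * X i) else 0 := by
    rw [koszulD, Fintype.linearCombination_apply, Finset.sum_apply]
    refine Finset.sum_congr rfl fun J _ => ?_
    rw [Pi.smul_apply, Finset.sum_apply, smul_eq_mul, Finset.mul_sum]
    simp_rw [ite_and]
    rw [Finset.sum_ite_mem, Finset.univ_inter]
    refine Finset.sum_congr rfl fun i _ => ?_
    rw [Pi.smul_apply, kBasis_apply, smul_eq_mul, mul_ite, mul_one, mul_zero, mul_ite, mul_zero]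
    rfl
  rw [h1, Finset.sum_comm, extBoundary_apply, ← Finset.univ_inter M.1ᶜ, ← Finset.sum_ite_mem]
  refine Finset.sum_congr rfl fun i _ => ?_
  by_cases hi : i ∈ M.1
  · rw [if_neg (by simpa using hi)]
    refine Finset.sum_eq_zero fun J _ => if_neg ?_
    rintro ⟨_, h⟩
    rw [← h] at hi
    simp at hi
  · rw [if_pos (by simpa using hi)]
    have hc : (insert i M.1).card = j := by
      rw [Finset.card_insert_of_notMem hi, M.2]; omega
    rw [Finset.sum_eq_single ⟨insert i M.1, hc⟩]
    · rw [if_pos ⟨Finset.mem_insert_self _ _, Finset.erase_insert hi⟩, extendKoszul, dif_pos hc,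
        koszulSign_insert_of_le _ le_rfl]
      ring
    · intro J _ hJ
      refine if_neg ?_
      rintro ⟨h, h'⟩
      exact hJ (Subtype.ext ((Finset.insert_erase h).symm.trans (by rw [h'])))
    · simp

/-- Exactness of the Koszul complex in positive degrees. -/
theorem mem_syz_iff {m : ℕ} (hm : 2 ≤ m) (v : Koszul k n (m - 1)) :
    v ∈ syz k n m ↔ koszulD k n (m - 1) v = 0 := by
  constructor
  · rintro ⟨w, rfl⟩
    funext M
    rw [koszulD_apply (by omega), extBoundary_congr (g := extBoundary k n (extendKoszul w)) _ M.2,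
      extBoundary_extBoundary]
    · rfl
    · intro J hJ
      have hJ' : J.card = m - 1 := by omega
      rw [extendKoszul, dif_pos hJ', koszulD_apply (by omega)]
  · intro h
    have hb : extBoundary k n (extendKoszul v) = 0 := by
      funext M
      by_cases hM : M.card = m - 1 - 1
      · rw [← koszulD_apply (by omega) v ⟨M, hM⟩, h]; rfl
      · rw [extBoundary_apply]
        refine Finset.sum_eq_zero fun i hi => ?_
        rw [extendKoszul, dif_neg, mul_zero]
        rw [Finset.card_insert_of_notMem (Finset.mem_compl.1 hi)]
        omega
    -- Since $m\ge 2$, the extension by zero of $v$ vanishes at $\emptyset$, the only place where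
    -- exactness can fail.
    obtain ⟨g, hg⟩ := exists_extBoundary_eq _ hb
      (by rw [extendKoszul, dif_neg]; rw [Finset.card_empty]; omega)
    refine ⟨fun J => g J.1, funext fun M => ?_⟩
    rw [koszulD_apply (by omega), extBoundary_congr (g := g) _ M.2, hg, extendKoszul, dif_pos M.2]
    intro J hJ
    exact dif_pos (by omega)

/-- Exactness of the dual Koszul complex away from its top degree. -/
theorem mem_span_of_comp_koszulD_eq_zero {m : ℕ} (hm : 2 ≤ m) (hmn : m ≤ n)
    (α : Koszul k n (m - 1) →ₗ[Poly k n] Poly k n) (h : ∀ w, α (koszulD k n m w) = 0) :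
    α ∈ Submodule.span (Poly k n) {ψ | ∃ M : Finset (Fin n), M.card = m - 2 ∧
      ψ = ∑ i ∈ Mᶜ, (koszulSign k i M * X i) • kDual k (m - 1) (insert i M)} := by
  -- The coefficients of $\alpha$, extended by zero, form a cocycle in every degree, and the
  -- coefficient at $[n]$ is zero because $m-1<n$. Only the values of $b$ on sets of size $m-2$ are
  -- used below.
  obtain ⟨b, hb⟩ := exists_dual_extBoundary_eq (fun J => α (kBasis k (m - 1) J)) (by
      intro J
      by_cases hJ : J.card = m
      · rw [← h (Pi.single ⟨J, hJ⟩ 1), koszulD_single, map_sum]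
        exact Finset.sum_congr rfl fun i _ => by rw [map_smul, smul_eq_mul]
      · refine Finset.sum_eq_zero fun i hi => ?_
        have := Finset.card_pos.2 ⟨i, hi⟩
        rw [kBasis_of_card_ne (by rw [Finset.card_erase_of_mem hi]; omega), map_zero, mul_zero])
    (by
      rw [kBasis_of_card_ne (by rw [Finset.card_univ, Fintype.card_fin]; omega), map_zero])
  have key : α = ∑ J ∈ Finset.powersetCard (m - 1) Finset.univ,
      α (kBasis k (m - 1) J) • kDual k (m - 1) J := by
    refine LinearMap.pi_ext' fun M => LinearMap.ext_ring ?_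
    simp only [LinearMap.comp_apply, LinearMap.sum_apply, LinearMap.smul_apply,
      LinearMap.single_apply, kDual_apply_single, smul_eq_mul, mul_ite, mul_one, mul_zero]
    rw [Finset.sum_ite_eq' , if_pos (by simpa using M.2)]
    rw [kBasis, dif_pos M.2]
  have key' : α = ∑ M ∈ Finset.powersetCard (m - 2) Finset.univ,
      b M • ∑ i ∈ Mᶜ, (koszulSign k i M * X i) • kDual k (m - 1) (insert i M) := by
    rw [key]
    simp_rw [hb, Finset.sum_smul, Finset.smul_sum]
    rw [Finset.sum_sigma', Finset.sum_sigma']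
    refine Finset.sum_bij' (fun x _ => ⟨x.1.erase x.2, x.2⟩) (fun x _ => ⟨insert x.2 x.1, x.2⟩)
      ?_ ?_ ?_ ?_ ?_
    · rintro ⟨J, i⟩ hJ
      simp only [Finset.mem_sigma, Finset.mem_powersetCard, Finset.subset_univ, true_and] at hJ
      simp only [Finset.mem_sigma, Finset.mem_powersetCard, Finset.subset_univ, true_and,
        Finset.mem_compl, Finset.notMem_erase, not_false_eq_true, and_true]
      rw [Finset.card_erase_of_mem hJ.2]; omega
    · rintro ⟨M, i⟩ hM
      simp only [Finset.mem_sigma, Finset.mem_powersetCard, Finset.subset_univ, true_and,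
        Finset.mem_compl] at hM
      simp only [Finset.mem_sigma, Finset.mem_powersetCard, Finset.subset_univ, true_and,
        Finset.mem_insert_self, and_true]
      rw [Finset.card_insert_of_notMem hM.2]; omega
    · rintro ⟨J, i⟩ hJ
      simp only [Finset.mem_sigma] at hJ
      simp [Finset.insert_erase hJ.2]
    · rintro ⟨M, i⟩ hM
      simp only [Finset.mem_sigma, Finset.mem_compl] at hM
      simp [Finset.erase_insert hM.2]
    · rintro ⟨J, i⟩ hJ
      simp only [Finset.mem_sigma] at hJ
      simp only
      rw [Finset.insert_erase hJ.2, smul_smul, koszulSign_erase_self]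
      congr 1
      ring
  rw [key']
  exact Submodule.sum_mem _ fun M hM => Submodule.smul_mem _ _ (Submodule.subset_span
    ⟨M, (Finset.mem_powersetCard.1 hM).2, rfl⟩)

/-- The number of pairs `(a, b) ∈ A × B` with `b < a`. -/
def inversions (A B : Finset (Fin n)) : ℕ := ((A ×ˢ B).filter fun p => p.2 < p.1).card

theorem inversions_eq_sum_left (A B : Finset (Fin n)) :
    inversions A B = ∑ a ∈ A, (B.filter (· < a)).card := by
  simp only [inversions, Finset.card_filter, Finset.sum_product]

theorem inversions_eq_sum_right (A B : Finset (Fin n)) :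
    inversions A B = ∑ b ∈ B, (A.filter (b < ·)).card := by
  simp only [inversions, Finset.card_filter, Finset.sum_product_right]

/-- Moving $i$ from $L$ to $M$ loses the pairs $(i,b)$ with $b\in M$, $b<i$, and gains the pairs
$(l,i)$ with $l\in L$, $l>i$. Modulo $2$ this compares the sign $\sigma$ in $\mathcal A$ with the
Koszul sign. -/
theorem inversions_erase_insert {L M : Finset (Fin n)} {i : Fin n} (hL : i ∈ L) (hM : i ∉ M) :
    inversions (L.erase i) (insert i M) + (M.filter (· < i)).card + (L.filter (· ≤ i)).card =
      inversions L M + L.card := by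
  have h1 : inversions (L.erase i) (insert i M) =
      (L.filter (i < ·)).card + inversions (L.erase i) M := by
    rw [inversions_eq_sum_right, Finset.sum_insert hM, ← inversions_eq_sum_right]
    congr 2
    ext l
    simp only [Finset.mem_filter, Finset.mem_erase]
    exact ⟨fun h => ⟨h.1.2, h.2⟩, fun h => ⟨⟨h.2.ne', h.1⟩, h.2⟩⟩
  have h2 : inversions L M = (M.filter (· < i)).card + inversions (L.erase i) M := by
    rw [inversions_eq_sum_left, inversions_eq_sum_left, ← Finset.add_sum_erase _ _ hL]
  have h3 : (L.filter (· ≤ i)).card + (L.filter (i < ·)).card = L.card := by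
    simp_rw [← not_le]
    exact Finset.card_filter_add_card_filter_not _
  omega

/-- The coboundary of $e_M^*$ is, up to one global sign, the generator of $\mathcal A$ belonging to
$L=[n]\setminus M$. -/
theorem mem_spanA {t : ℕ} (ht : t + 2 ≤ n)
    (α : Koszul k n (t + 1) →ₗ[Poly k n] Poly k n) (h : ∀ w, α (koszulD k n (t + 2) w) = 0) :
    α ∈ spanA k n t := by
  refine (Submodule.span_le.2 ?_) (mem_span_of_comp_koszulD_eq_zero (by omega) ht α h)
  rintro _ ⟨M, hM, rfl⟩
  have hgen : ∑ i ∈ Mᶜ, (koszulSign k i M * X i) • kDual k (t + 1) (insert i M) =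
      ((-1 : Poly k n) ^ (inversions Mᶜ M + Mᶜ.card + 1)) • ∑ i ∈ Mᶜ,
        ((-1 : Poly k n) ^ ((Mᶜ.filter (· ≤ i)).card + 1) *
          ((sigma (Mᶜ.erase i) (Mᶜᶜ ∪ {i}) : ℤ) : Poly k n) * X i) •
            kDual k (t + 1) (Mᶜᶜ ∪ {i}) := by
    rw [Finset.smul_sum]
    refine Finset.sum_congr rfl fun i hi => ?_
    rw [compl_compl, Finset.union_singleton, smul_smul]
    congr 1
    have hc := inversions_erase_insert hi (Finset.mem_compl.1 hi)
    have hs : ((sigma (Mᶜ.erase i) (insert i M) : ℤ) : Poly k n) =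
        (-1) ^ inversions (Mᶜ.erase i) (insert i M) := by
      simp [sigma, inversions]
    have h2 : (-1 : Poly k n) ^ (inversions Mᶜ M + Mᶜ.card + 1) *
        ((-1) ^ ((Mᶜ.filter (· ≤ i)).card + 1) *
          (-1) ^ inversions (Mᶜ.erase i) (insert i M)) = koszulSign k i M := by
      rw [koszulSign, ← hc, ← pow_add, ← pow_add]
      rw [neg_one_pow_eq_pow_mod_two, neg_one_pow_eq_pow_mod_two (n := (M.filter (· < i)).card)]
      congr 1
      omega
    rw [hs, ← h2]
    ring
  refine (congrArg (· ∈ spanA k n t) hgen).mpr ?_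
  refine Submodule.smul_mem _ _ (Submodule.subset_span ⟨Mᶜ, ?_, rfl⟩)
  rw [Finset.card_compl, Fintype.card_fin, hM]
  omega

/-- Here $M$ omits just two indices $i<j$, so the coboundary of $e_M^*$ has two terms and is a
generator of $\mathcal B$ up to sign. -/
theorem mem_spanB (hn : 2 ≤ n)
    (α : Koszul k n (n - 1) →ₗ[Poly k n] Poly k n) (h : ∀ w, α (koszulD k n n w) = 0) :
    α ∈ spanB k n := by
  refine (Submodule.span_le.2 ?_) (mem_span_of_comp_koszulD_eq_zero hn le_rfl α h)
  rintro _ ⟨M, hM, rfl⟩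
  obtain ⟨i, j, hij, hMc⟩ : ∃ i j : Fin n, i < j ∧ Mᶜ = {i, j} := by
    have : Mᶜ.card = 2 := by rw [Finset.card_compl, Fintype.card_fin, hM]; omega
    obtain ⟨i, j, hij, h⟩ := Finset.card_eq_two.1 this
    rcases lt_or_gt_of_ne hij with h' | h'
    · exact ⟨i, j, h', h⟩
    · exact ⟨j, i, h', by rw [h, Finset.pair_comm]⟩
  have hmem : ∀ l, l ∈ M ↔ l ≠ i ∧ l ≠ j := fun l => by
    have : l ∈ Mᶜ ↔ l = i ∨ l = j := by rw [hMc]; simp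
    rw [Finset.mem_compl] at this
    tauto
  have hi : insert i M = Finset.univ.erase j := by
    ext l
    simp only [Finset.mem_insert, hmem, Finset.mem_erase, Finset.mem_univ, and_true]
    have := hij.ne
    constructor
    · rintro (rfl | h) <;> tauto
    · tauto
  have hj : insert j M = Finset.univ.erase i := by
    ext l
    simp only [Finset.mem_insert, hmem, Finset.mem_erase, Finset.mem_univ, and_true]
    have := hij.ne'
    constructor
    · rintro (rfl | h) <;> tauto
    · tauto
  have hsi : koszulSign k i M = (-1) ^ (i : ℕ) := by
    rw [koszulSign, show M.filter (· < i) = Finset.Iio i from ?_, Fin.card_Iio]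
    ext l
    simp only [Finset.mem_filter, hmem, Finset.mem_Iio]
    exact ⟨fun h => h.2, fun h => ⟨⟨h.ne, (h.trans hij).ne⟩, h⟩⟩
  -- Of the indices below $j$, only $i$ is missing from $M$, which costs one sign.
  have hsj : koszulSign k j M * (-1) = (-1) ^ (j : ℕ) := by
    have := koszulSign_insert_of_lt (k := k) (i := j) (j := i) (M := M) (by simp [hmem]) hij
    rw [mul_neg_one, ← this, koszulSign, hi,
      show (Finset.univ.erase j).filter (· < j) = Finset.Iio j from ?_, Fin.card_Iio]
    ext l
    simp only [Finset.mem_filter, Finset.mem_erase, Finset.mem_univ, and_true, Finset.mem_Iio]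
    exact ⟨fun h => h.2, fun h => ⟨h.ne, h⟩⟩
  have hone : ∀ e : ℕ, (-1 : Poly k n) ^ e * (-1) ^ e = 1 := fun e => by
    rw [← mul_pow]; simp
  rw [hMc, Finset.sum_pair hij.ne, hi, hj]
  have hgen : (koszulSign k i M * X i) • kDual k (n - 1) (Finset.univ.erase j) +
      (koszulSign k j M * X j) • kDual k (n - 1) (Finset.univ.erase i) =
      ((-1 : Poly k n) ^ ((i : ℕ) + j)) •
        (((-1 : Poly k n) ^ ((i : ℕ) + 1) * X j) • kDual k (n - 1) (Finset.univ.erase i) -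
        ((-1 : Poly k n) ^ ((j : ℕ) + 1) * X i) • kDual k (n - 1) (Finset.univ.erase j)) := by
    rw [smul_sub, smul_smul, smul_smul, add_comm, sub_eq_add_neg, ← neg_smul]
    congr 2
    · rw [pow_add, pow_add, pow_one]
      linear_combination (-X j) * hsj - (-1) ^ (j : ℕ) * (-X j) * hone i
    · rw [hsi, pow_add, pow_add, pow_one]
      linear_combination (-(-1) ^ (i : ℕ) * X i) * hone j
  rw [hgen]
  exact Submodule.smul_mem _ _ (Submodule.subset_span ⟨i, j, hij, rfl⟩)

end KoszulExactness

/-! ### Homogeneous components, and the graded cover of $E_{t+1}\oplus E_{n-1}(d)$ -/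

section HomogeneousComponents

variable {k : Type*} [Field k] {n : ℕ}

theorem polyGrading_natCast (i : ℕ) :
    polyGrading k n (i : ℤ) = homogeneousSubmodule (Fin n) k i := by
  simp [polyGrading]

theorem polyGrading_of_neg {m : ℤ} (hm : m < 0) : polyGrading k n m = ⊥ :=
  if_neg (not_le.mpr hm)

theorem mul_mem_polyGrading {e m : ℤ} {u v : Poly k n} (hu : u ∈ polyGrading k n e)
    (hv : v ∈ polyGrading k n m) : u * v ∈ polyGrading k n (e + m) := by
  rcases lt_or_ge e 0 with he | he
  · rw [polyGrading_of_neg he, Submodule.mem_bot] at hu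
    simp [hu]
  rcases lt_or_ge m 0 with hm | hm
  · rw [polyGrading_of_neg hm, Submodule.mem_bot] at hv
    simp [hv]
  lift e to ℕ using he
  lift m to ℕ using hm
  rw [polyGrading_natCast, mem_homogeneousSubmodule] at hu hv
  rw [← Nat.cast_add, polyGrading_natCast, mem_homogeneousSubmodule]
  exact hu.mul hv

theorem one_mem_polyGrading : (1 : Poly k n) ∈ polyGrading k n 0 := by
  rw [← Nat.cast_zero, polyGrading_natCast]
  exact isHomogeneous_one _ _

theorem X_mem_polyGrading (i : Fin n) : (X i : Poly k n) ∈ polyGrading k n 1 := by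
  rw [← Nat.cast_one, polyGrading_natCast]
  exact isHomogeneous_X _ _

theorem koszulSign_mul_mem_polyGrading {m : ℤ} {u : Poly k n} (hu : u ∈ polyGrading k n m)
    (i : Fin n) (M : Finset (Fin n)) : koszulSign k i M * u ∈ polyGrading k n m := by
  rcases koszulSign_eq_or (k := k) i M with h | h <;> simpa [h] using hu

/-- The projection of `S` onto its homogeneous component of degree `m ∈ ℤ`. -/
noncomputable def polyComponent (m : ℤ) : Poly k n →ₗ[k] Poly k n :=
  if 0 ≤ m then homogeneousComponent m.toNat else 0

theorem polyComponent_mem (m : ℤ) (u : Poly k n) : polyComponent m u ∈ polyGrading k n m := by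
  rcases lt_or_ge m 0 with hm | hm
  · rw [polyComponent, if_neg (not_le.mpr hm)]
    exact zero_mem _
  · rw [polyComponent, if_pos hm, polyGrading, if_pos hm]
    exact homogeneousComponent_mem _ _

theorem polyComponent_of_mem {e m : ℤ} {u : Poly k n} (hu : u ∈ polyGrading k n e) :
    polyComponent m u = if e = m then u else 0 := by
  rcases lt_or_ge e 0 with he | he
  · rw [polyGrading_of_neg he, Submodule.mem_bot] at hu
    simp [hu]
  lift e to ℕ using he
  rw [polyGrading_natCast] at hu
  rcases lt_or_ge m 0 with hm | hm
  · rw [polyComponent, if_neg (not_le.mpr hm), if_neg (by omega)]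
    rfl
  · lift m to ℕ using hm
    rw [polyComponent, if_pos (by omega), Int.toNat_natCast, homogeneousComponent_of_mem hu]
    simp only [Nat.cast_inj, eq_comm]

theorem polyComponent_self {m : ℤ} {u : Poly k n} (hu : u ∈ polyGrading k n m) :
    polyComponent m u = u := by
  rw [polyComponent_of_mem hu, if_pos rfl]

/-- Both sides are additive in $u$, and for a monomial both vanish unless its degree is $m$. -/
theorem polyComponent_mul {e : ℤ} {v : Poly k n} (hv : v ∈ polyGrading k n e) (m : ℤ)
    (u : Poly k n) : polyComponent (m + e) (u * v) = polyComponent m u * v := by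
  induction u using MvPolynomial.induction_on' with
  | monomial s c =>
    have hu : monomial s c ∈ polyGrading k n (s.degree : ℤ) := by
      rw [polyGrading_natCast]
      exact isHomogeneous_monomial c rfl
    rw [polyComponent_of_mem hu, polyComponent_of_mem (mul_mem_polyGrading hu hv)]
    by_cases h : (s.degree : ℤ) = m
    · rw [if_pos h, if_pos (by omega)]
    · rw [if_neg h, if_neg (by omega), zero_mul]
  | add p q hp hq => rw [add_mul, map_add, map_add, hp, hq, add_mul]

theorem mem_freeGrading {ι : Type*} {w : ι → ℤ} {m : ℤ} {v : ι → Poly k n} :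
    v ∈ freeGrading w m ↔ ∀ i, v i ∈ polyGrading k n (-w i + m) := by
  simp [freeGrading, shift, Submodule.mem_pi]

theorem single_mem_freeGrading {ι : Type*} [DecidableEq ι] (w : ι → ℤ) (i : ι) :
    (Pi.single i 1 : ι → Poly k n) ∈ freeGrading (k := k) w (w i) := by
  rw [mem_freeGrading]
  intro l
  rw [Pi.single_apply]
  split_ifs with h
  · subst h
    rw [neg_add_cancel]
    exact one_mem_polyGrading
  · exact zero_mem _

theorem smul_mem_freeGrading {ι : Type*} {w : ι → ℤ} {e m : ℤ} {u : Poly k n} {v : ι → Poly k n}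
    (hu : u ∈ polyGrading k n e) (hv : v ∈ freeGrading (k := k) w m) :
    u • v ∈ freeGrading (k := k) w (e + m) := by
  rw [mem_freeGrading] at hv ⊢
  intro i
  rw [show -w i + (e + m) = e + (-w i + m) by ring]
  exact mul_mem_polyGrading hu (hv i)

/-- The projection of `⨁_i S(-w_i)` onto its component of degree `m`. -/
noncomputable def freeComponent {ι : Type*} (w : ι → ℤ) (m : ℤ) (v : ι → Poly k n) :
    ι → Poly k n :=
  fun i => polyComponent (-w i + m) (v i)

theorem freeComponent_mem {ι : Type*} (w : ι → ℤ) (m : ℤ) (v : ι → Poly k n) :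
    freeComponent w m v ∈ freeGrading (k := k) w m :=
  mem_freeGrading.2 fun _ => polyComponent_mem _ _

theorem freeComponent_self {ι : Type*} {w : ι → ℤ} {m : ℤ} {v : ι → Poly k n}
    (hv : v ∈ freeGrading (k := k) w m) : freeComponent w m v = v :=
  funext fun i => polyComponent_self (mem_freeGrading.1 hv i)

/-- Homogeneous maps of degree `0` between free modules commute with the projections onto the
homogeneous components. -/
theorem map_freeComponent {ι κ : Type*} [Fintype ι] [DecidableEq ι] {a : ι → ℤ} {b : κ → ℤ}
    {F : (ι → Poly k n) →ₗ[Poly k n] (κ → Poly k n)}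
    (hF : IsHomogeneousHom (k := k) (freeGrading a) (freeGrading b) 0 F) (m : ℤ)
    (v : ι → Poly k n) : F (freeComponent a m v) = freeComponent b m (F v) := by
  funext l
  rw [LinearMap.pi_apply_eq_sum_univ F v, LinearMap.pi_apply_eq_sum_univ F (freeComponent a m v)]
  simp only [freeComponent, Finset.sum_apply, Pi.smul_apply, smul_eq_mul, map_sum]
  refine Finset.sum_congr rfl fun i _ => ?_
  have h := mem_freeGrading.1 (hF _ _ (single_mem_freeGrading a i)) l
  rw [show (fun j => if i = j then (1 : Poly k n) else 0) = Pi.single i 1 by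
    funext j; simp [Pi.single_apply, eq_comm], ← polyComponent_mul h]
  congr 2
  ring

theorem isHomogeneousHom_koszulD {j : ℕ} (hj : 1 ≤ j) :
    IsHomogeneousHom (koszulGrading k n j) (koszulGrading k n (j - 1)) 0 (koszulD k n j) := by
  intro m v hv
  rw [koszulGrading, mem_freeGrading] at hv ⊢
  intro M
  rw [koszulD_apply hj, extBoundary_apply]
  refine Submodule.sum_mem _ fun i hi => ?_
  rw [mul_assoc]
  refine koszulSign_mul_mem_polyGrading ?_ _ _
  rw [extendKoszul, dif_pos (by
    rw [Finset.card_insert_of_notMem (Finset.mem_compl.1 hi), M.2]; omega),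
    show -((j - 1 : ℕ) : ℤ) + (m + 0) = 1 + (-(j : ℤ) + m) by omega]
  exact mul_mem_polyGrading (X_mem_polyGrading i) (hv _)

/-- Homogeneous elements of `E_j` have homogeneous preimages in `K_j`. -/
theorem exists_koszulD_eq_of_mem {j : ℕ} (hj : 1 ≤ j) {m : ℤ} {v : Koszul k n (j - 1)}
    (hv : v ∈ syz k n j) (hm : v ∈ koszulGrading k n (j - 1) m) :
    ∃ w ∈ koszulGrading k n j m, koszulD k n j w = v := by
  obtain ⟨w, rfl⟩ := hv
  refine ⟨freeComponent (fun _ => (j : ℤ)) m w, freeComponent_mem _ _ _, ?_⟩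
  rw [map_freeComponent (b := fun _ => ((j - 1 : ℕ) : ℤ)) (isHomogeneousHom_koszulD hj),
    freeComponent_self hm]

theorem smul_mem_coverGrading {t : ℕ} {d e m : ℤ} {u : Poly k n} {v : Cover k n t}
    (hu : u ∈ polyGrading k n e) (hv : v ∈ coverGrading k n t d m) :
    u • v ∈ coverGrading k n t d (e + m) := by
  refine ⟨smul_mem_freeGrading hu hv.1, ?_⟩
  have := smul_mem_freeGrading hu hv.2
  rwa [add_left_comm] at this

theorem isHomogeneousHom_betaMap {t q : ℕ} {d : ℤ} {b : Fin q → ℤ} {β : Fin q → Cover k n t}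
    (hβ : ∀ i, β i ∈ coverGrading k n t d (b i)) :
    IsHomogeneousHom (k := k) (freeGrading b) (coverGrading k n t d) 0 (betaMap β) := by
  intro m v hv
  rw [betaMap, Fintype.linearCombination_apply]
  refine Submodule.sum_mem _ fun i _ => ?_
  have := smul_mem_coverGrading (mem_freeGrading.1 hv i) (hβ i)
  rwa [show -b i + m + b i = m + 0 by ring] at this

/-- The surjection `K_j → E_j` given by the differential. -/
noncomputable def toSyz (k : Type*) [Field k] (n j : ℕ) : Koszul k n j →ₗ[Poly k n] syz k n j :=
  (koszulD k n j).rangeRestrict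

theorem toSyz_surjective (j : ℕ) : Function.Surjective (toSyz k n j) :=
  LinearMap.surjective_rangeRestrict _

theorem toSyz_eq_zero_iff {m : ℕ} (hm : 2 ≤ m) (v : Koszul k n (m - 1)) :
    toSyz k n (m - 1) v = 0 ↔ v ∈ syz k n m := by
  rw [mem_syz_iff hm, Subtype.ext_iff]
  rfl

/-- The surjection `K_{t+1} ⊕ K_{n-1}(d) → E_{t+1} ⊕ E_{n-1}(d)` given by the differentials. -/
noncomputable def coverMap (k : Type*) [Field k] (n t : ℕ) : Cover k n t →ₗ[Poly k n] Approx k n t :=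
  (toSyz k n (t + 1)).prodMap (toSyz k n (n - 1))

theorem coverMap_surjective (t : ℕ) : Function.Surjective (coverMap k n t) :=
  (toSyz_surjective _).prodMap (toSyz_surjective _)

theorem ker_coverMap {t : ℕ} (ht : t + 3 ≤ n) : LinearMap.ker (coverMap k n t) = coverSyz k n t := by
  ext ⟨u, v⟩
  rw [LinearMap.mem_ker, coverMap, LinearMap.prodMap_apply, Prod.mk_eq_zero,
    toSyz_eq_zero_iff (by omega)]
  exact and_congr_left' (toSyz_eq_zero_iff (m := t + 2) (by omega) u)

theorem coverMap_mem_approxGrading {t : ℕ} (ht : t + 3 ≤ n) {d m : ℤ} {v : Cover k n t}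
    (hv : v ∈ coverGrading k n t d m) : coverMap k n t v ∈ approxGrading k n t d m := by
  constructor
  · have := isHomogeneousHom_koszulD (k := k) (n := n) (j := t + 1) (by omega) _ _ hv.1
    rw [add_zero] at this
    exact this
  · have := isHomogeneousHom_koszulD (k := k) (n := n) (j := n - 1) (by omega) _ _ hv.2
    rw [add_zero] at this
    exact this

theorem exists_coverMap_eq {t : ℕ} (ht : t + 3 ≤ n) {d m : ℤ} {v : Approx k n t}
    (hv : v ∈ approxGrading k n t d m) :
    ∃ w ∈ coverGrading k n t d m, coverMap k n t w = v := by
  obtain ⟨w₁, h₁, e₁⟩ := exists_koszulD_eq_of_mem (j := t + 1) (by omega) v.1.2 hv.1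
  obtain ⟨w₂, h₂, e₂⟩ := exists_koszulD_eq_of_mem (j := n - 1) (by omega) v.2.2 hv.2
  exact ⟨(w₁, w₂), ⟨h₁, h₂⟩, Prod.ext (Subtype.ext e₁) (Subtype.ext e₂)⟩

end HomogeneousComponents

/-! ### Ranks, minimality and projective dimension -/

section RankAndProjectiveDimension

variable {k : Type*} [Field k] {n : ℕ}

theorem koszulD_single_apply {j : ℕ} (J : {J : Finset (Fin n) // J.card = j}) {i : Fin n}
    (hi : i ∈ J.1) (M : {M : Finset (Fin n) // M.card = j - 1}) (hM : J.1.erase i = M.1) :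
    koszulD k n j (Pi.single J 1) M = koszulSign k i J.1 * X i := by
  rw [koszulD_single, Finset.sum_apply, Finset.sum_eq_single_of_mem i hi]
  · rw [Pi.smul_apply, kBasis_apply, if_pos hM, smul_eq_mul, mul_one]
  · intro l hl hli
    rw [Pi.smul_apply, kBasis_apply, if_neg, smul_zero]
    rw [← hM]
    intro h
    have : i ∈ J.1.erase l := Finset.mem_erase.2 ⟨hli.symm, hi⟩
    rw [h] at this
    simp at this

theorem koszulSign_ne_zero (i : Fin n) (M : Finset (Fin n)) : koszulSign k i M ≠ 0 := by
  rcases koszulSign_eq_or (k := k) i M with h | h <;> simp [h]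

theorem finrank_koszul (j : ℕ) : Module.finrank (Poly k n) (Koszul k n j) = n.choose j := by
  rw [Module.finrank_fintype_fun_eq_card, Fintype.card_finset_len, Fintype.card_fin]

theorem finrank_range_add_finrank_ker_of_isDomain {R M N : Type*} [CommRing R] [IsDomain R]
    [AddCommGroup M] [Module R M] [Module.Finite R M] [AddCommGroup N] [Module R N]
    (f : M →ₗ[R] N) : Module.finrank R (LinearMap.range f) + Module.finrank R (LinearMap.ker f) =
      Module.finrank R M := by
  rw [← (LinearMap.ker f).finrank_quotient_add_finrank, f.quotKerEquivRange.finrank_eq]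

/-- Exactness makes the ranks of $E_{j+1}$ and $E_{j+2}$ add up to $\binom n{j+1}$, so Pascal's rule
gives the induction. It starts from $E_1$, a nonzero submodule of the rank one module $K_0$. -/
theorem finrank_syz_succ (hn : 1 ≤ n) (j : ℕ) :
    Module.finrank (Poly k n) (syz k n (j + 1)) = (n - 1).choose j := by
  induction j with
  | zero =>
    rw [Nat.choose_zero_right]
    refine le_antisymm ?_ ?_
    · refine (Submodule.finrank_le _).trans ?_
      rw [finrank_koszul]
      simp
    · have : Nontrivial (syz k n (0 + 1)) := by
        let J : {J : Finset (Fin n) // J.card = 1} := ⟨{⟨0, hn⟩}, rfl⟩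
        refine ⟨⟨toSyz k n 1 (Pi.single J 1), 0, fun h => ?_⟩⟩
        have h' : koszulD k n 1 (Pi.single J 1) = 0 := congrArg Subtype.val h
        have h0 := koszulD_single_apply (k := k) J (Finset.mem_singleton_self _) ⟨∅, rfl⟩ (by simp [J])
        rw [h'] at h0
        exact mul_ne_zero (koszulSign_ne_zero _ _) (X_ne_zero _) h0.symm
      exact Nat.succ_le_of_lt Module.finrank_pos
  | succ j ih =>
    have h := finrank_range_add_finrank_ker_of_isDomain (koszulD k n (j + 1))
    have hk : LinearMap.ker (koszulD k n (j + 1)) = syz k n (j + 1 + 1) := by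
      ext v
      rw [LinearMap.mem_ker]
      exact (mem_syz_iff (m := j + 2) (by omega) v).symm
    have hr : Module.finrank (Poly k n) (LinearMap.range (koszulD k n (j + 1))) =
      (n - 1).choose j := ih
    rw [hk, hr, finrank_koszul] at h
    obtain ⟨N, rfl⟩ : ∃ N, n = N + 1 := ⟨n - 1, by omega⟩
    rw [Nat.choose_succ_succ] at h
    simp only [Nat.add_sub_cancel] at h ⊢
    exact Nat.add_left_cancel h

theorem finrank_syz_pred (hn : 2 ≤ n) : Module.finrank (Poly k n) (syz k n (n - 1)) = n - 1 := by
  obtain ⟨N, rfl⟩ : ∃ N, n = N + 2 := ⟨n - 2, by omega⟩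
  exact (finrank_syz_succ (by omega) N).trans (Nat.choose_succ_self_right N)

theorem finrank_approx {t : ℕ} (ht : t + 3 ≤ n) :
    Module.finrank (Poly k n) (Approx k n t) = (n - 1).choose t + (n - 1) := by
  have h := finrank_range_add_finrank_ker_of_isDomain
    (LinearMap.fst (Poly k n) (syz k n (t + 1)) (syz k n (n - 1)))
  rw [Submodule.range_fst, finrank_top, LinearMap.ker_fst,
    LinearMap.finrank_range_of_inj LinearMap.inr_injective, finrank_syz_succ (by omega),
    finrank_syz_pred (by omega)] at h
  exact h.symm

theorem finrank_ideal {I : Ideal (Poly k n)} (hI : I ≠ ⊥) : Module.finrank (Poly k n) I = 1 := by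
  refine le_antisymm ?_ ?_
  · exact (Submodule.finrank_le I).trans (Module.finrank_self _).le
  · have : Nontrivial I := Submodule.nontrivial_iff_ne_bot.2 hI
    exact Nat.succ_le_of_lt Module.finrank_pos

theorem rank_relation {t : ℕ} (ht : t + 3 ≤ n) {p q : ℕ} {I : Ideal (Poly k n)} (hI : I ≠ ⊥)
    {f : (Fin p → Poly k n) →ₗ[Poly k n] (Fin q → Poly k n)}
    {g : (Fin q → Poly k n) →ₗ[Poly k n] Approx k n t} {φ : Approx k n t →ₗ[Poly k n] I}
    (hf : Function.Injective f) (hfg : Function.Exact f g) (hgφ : Function.Exact g φ)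
    (hφ : Function.Surjective φ) :
    (p : ℤ) = (q : ℤ) - (n : ℤ) + 2 - ((n - 1).choose t : ℤ) := by
  have h1 := finrank_range_add_finrank_ker_of_isDomain g
  have h2 := finrank_range_add_finrank_ker_of_isDomain φ
  rw [LinearMap.exact_iff.1 hfg, LinearMap.finrank_range_of_inj hf, Module.finrank_fin_fun,
    Module.finrank_fin_fun] at h1
  rw [LinearMap.exact_iff.1 hgφ, LinearMap.range_eq_top.2 hφ, finrank_top, finrank_ideal hI,
    finrank_approx ht] at h2
  omega

/-- Minimality: the nonzero matrix entries of the differential are variables up to sign. -/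
theorem constantCoeff_koszulD {j : ℕ} (hj : 1 ≤ j) (v : Koszul k n j)
    (M : {M : Finset (Fin n) // M.card = j - 1}) : constantCoeff (koszulD k n j v M) = 0 := by
  rw [koszulD_apply hj, extBoundary_apply, map_sum]
  exact Finset.sum_eq_zero fun i _ => by simp

theorem coeff_single_X_mul {u : Poly k n} (hu : constantCoeff u = 0) (i l : Fin n) :
    coeff (Finsupp.single i 1) (X l * u) = 0 := by
  rw [coeff_X_mul']
  split_ifs with h
  · rw [Finsupp.mem_support_iff, Finsupp.single_apply_ne_zero] at h
    rw [h.1, tsub_self]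
    exact hu
  · rfl

/-- The syzygy modules `E_j` with `2 ≤ j < n` are not projective. -/
theorem not_exists_section_toSyz {j : ℕ} (hj : 2 ≤ j) (hjn : j + 1 ≤ n) :
    ¬ ∃ s : syz k n j →ₗ[Poly k n] Koszul k n j, ∀ x, toSyz k n j (s x) = x := by
  rintro ⟨s, hs⟩
  -- A section would make $r$ a projection of $K_j$ onto $E_{j+1}$, which lies in $\mathfrak m K_j$
  -- for $\mathfrak m=(x_1,\dots,x_n)$.
  let r : Koszul k n j →ₗ[Poly k n] Koszul k n j := LinearMap.id - s ∘ₗ toSyz k n j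
  have hr : ∀ w M, constantCoeff (r w M) = 0 := by
    intro w M
    have h0 : toSyz k n j (r w) = 0 := by
      simp [r, hs]
    obtain ⟨y, hy⟩ := (toSyz_eq_zero_iff (m := j + 1) (by omega) (r w)).1 h0
    have := constantCoeff_koszulD (k := k) (j := j + 1) (by omega) y M
    rw [hy] at this
    exact this
  obtain ⟨J, hJ⟩ : ∃ J : Finset (Fin n), J.card = j + 1 := by
    obtain ⟨J, _, hJ⟩ := Finset.exists_subset_card_eq (s := (Finset.univ : Finset (Fin n)))
      (n := j + 1) (by simpa using hjn)
    exact ⟨J, hJ⟩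
  obtain ⟨i, hi⟩ : J.Nonempty := Finset.card_pos.1 (by omega)
  have hM : (J.erase i).card = j := by rw [Finset.card_erase_of_mem hi]; omega
  let y : Koszul k n j := koszulD k n (j + 1) (Pi.single ⟨J, hJ⟩ 1)
  have hy : toSyz k n j y = 0 :=
    (toSyz_eq_zero_iff (m := j + 1) (by omega) y).2 ⟨_, rfl⟩
  have hry : r y = y := by simp [r, hy]
  have hy1 : y = ∑ l ∈ J, (koszulSign k l J * X l) • kBasis k j (J.erase l) :=
    koszulD_single (k := k) (j := j + 1) ⟨J, hJ⟩
  have hy2 : y ⟨J.erase i, hM⟩ = koszulSign k i J * X i :=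
    koszulD_single_apply (j := j + 1) ⟨J, hJ⟩ hi ⟨J.erase i, hM⟩ rfl
  -- The element $y=\partial e_J$ has linear coefficients, so $r(y)\in\mathfrak m^2K_j$; but
  -- $r(y)=y$ has the coordinate $\pm x_i$.
  have hz : coeff (Finsupp.single i 1) (y ⟨J.erase i, hM⟩) = 0 := by
    rw [← hry, hy1, map_sum, Finset.sum_apply, coeff_sum]
    refine Finset.sum_eq_zero fun l _ => ?_
    rw [map_smul, Pi.smul_apply, smul_eq_mul]
    have := coeff_single_X_mul (hr (kBasis k j (J.erase l)) ⟨J.erase i, hM⟩) i l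
    rcases koszulSign_eq_or (k := k) l J with h | h <;> simp [h, this]
  rw [hy2] at hz
  rcases koszulSign_eq_or (k := k) i J with h | h <;> simp [h] at hz

/-- The module `E_{t+1} ⊕ E_{n-1}` has projective dimension greater than one. -/
theorem not_exact_of_surjective {t : ℕ} (ht : t + 3 ≤ n) {p q : ℕ}
    {f : (Fin p → Poly k n) →ₗ[Poly k n] (Fin q → Poly k n)}
    {g : (Fin q → Poly k n) →ₗ[Poly k n] Approx k n t}
    (hf : Function.Injective f) (hfg : Function.Exact f g) : ¬ Function.Surjective g := by
  intro hg
  refine not_exists_section_toSyz (k := k) (n := n) (j := t + 2) (by omega) ht ?_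
  obtain ⟨u, hu⟩ := Module.projective_lifting_property (coverMap k n t) g (coverMap_surjective t)
  obtain ⟨v, hv⟩ := Module.projective_lifting_property g (coverMap k n t) hg
  replace hu : ∀ y, coverMap k n t (u y) = g y := fun y => LinearMap.congr_fun hu y
  replace hv : ∀ x, g (v x) = coverMap k n t x := fun x => LinearMap.congr_fun hv x
  have hker : ∀ x : Cover k n t, coverMap k n t x = 0 → x.1 ∈ syz k n (t + 2) := fun x hx => by
    rw [← LinearMap.mem_ker, ker_coverMap ht] at hx
    exact hx.1
  -- On $E_{t+2}$ write the identity as $uv+(1-uv)$, up to the projection to $K_{t+1}$. The first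
  -- summand factors through $\bigoplus S(-a_i)\cong\operatorname{Im} f$ and the second through
  -- $K_{t+1}$. Both are free, so the identity lifts along $K_{t+2}\to E_{t+2}$.
  let h : (Fin p → Poly k n) →ₗ[Poly k n] syz k n (t + 2) :=
    (LinearMap.fst (Poly k n) (Koszul k n (t + 1)) (Koszul k n (n - 1)) ∘ₗ u ∘ₗ f).codRestrict _
      fun y => hker (u (f y)) (by rw [hu]; exact hfg.apply_apply_eq_zero y)
  let w₀ : Koszul k n (t + 1) →ₗ[Poly k n] syz k n (t + 2) :=
    (LinearMap.id - LinearMap.fst (Poly k n) (Koszul k n (t + 1)) (Koszul k n (n - 1)) ∘ₗ u ∘ₗ v ∘ₗ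
      LinearMap.inl (Poly k n) (Koszul k n (t + 1)) (Koszul k n (n - 1))).codRestrict _
      fun x => hker (((x, 0) : Cover k n t) - u (v (x, 0))) (by rw [map_sub, hu, hv, sub_self])
  obtain ⟨h', hh⟩ := Module.projective_lifting_property (toSyz k n (t + 2)) h (toSyz_surjective _)
  obtain ⟨w, hw⟩ := Module.projective_lifting_property (toSyz k n (t + 2)) w₀ (toSyz_surjective _)
  let e₀ : syz k n (t + 2) →ₗ[Poly k n] LinearMap.range f :=
    (v ∘ₗ LinearMap.inl (Poly k n) (Koszul k n (t + 1)) (Koszul k n (n - 1)) ∘ₗ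
      (syz k n (t + 2)).subtype).codRestrict _ fun x => (hfg _).1 (by
        change g (v (x.1, 0)) = 0
        rw [hv, ← LinearMap.mem_ker, ker_coverMap ht]
        exact ⟨x.2, zero_mem _⟩)
  let e := (LinearEquiv.ofInjective f hf).symm.toLinearMap ∘ₗ e₀
  have he : ∀ x, f (e x) = v (x.1, 0) := fun x =>
    congrArg Subtype.val ((LinearEquiv.ofInjective f hf).apply_symm_apply (e₀ x))
  refine ⟨h' ∘ₗ e + w ∘ₗ (syz k n (t + 2)).subtype, fun x => ?_⟩
  have h1 : toSyz k n (t + 2) (h' (e x)) = h (e x) := LinearMap.congr_fun hh _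
  have h2 : toSyz k n (t + 2) (w x.1) = w₀ x.1 := LinearMap.congr_fun hw _
  rw [LinearMap.add_apply, map_add]
  change toSyz k n (t + 2) (h' (e x)) + toSyz k n (t + 2) (w x.1) = x
  rw [h1, h2]
  refine Subtype.ext ?_
  change (u (f (e x))).1 + ((show Koszul k n (t + 1) from x.1) - (u (v (x.1, 0))).1) = x.1
  rw [he, add_sub_cancel]

end RankAndProjectiveDimension

/-! ### Passing between sequences and constructions -/

section Construction

variable {k : Type*} [Field k] {n : ℕ}

theorem range_betaMap {t q : ℕ} (β : Fin q → Cover k n t) :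
    LinearMap.range (betaMap β) = Submodule.span (Poly k n) (Set.range β) :=
  Fintype.range_linearCombination _ _

theorem betaMap_single {t q : ℕ} (β : Fin q → Cover k n t) (i : Fin q) :
    betaMap β (Pi.single i 1) = β i := by
  rw [betaMap, Fintype.linearCombination_apply_single, one_smul]

theorem IsLongBourbaki.ideal_ne_bot {t : ℕ} (ht : t + 3 ≤ n) {c d : ℤ} {p q : ℕ} {a : Fin p → ℤ}
    {b : Fin q → ℤ} {I : Ideal (Poly k n)}
    {f : (Fin p → Poly k n) →ₗ[Poly k n] (Fin q → Poly k n)}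
    {g : (Fin q → Poly k n) →ₗ[Poly k n] Approx k n t} {φ : Approx k n t →ₗ[Poly k n] I}
    (h : IsLongBourbaki t c d a b I f g φ) : I ≠ ⊥ := by
  rintro rfl
  exact not_exact_of_surjective ht h.injective_f h.exact_fg
    fun y => (h.exact_gφ y).1 (Subsingleton.elim _ _)

/-- A long Bourbaki sequence in which no basis element is mapped to zero comes from elements
`β_i` and a map `φ` as in the construction. -/
theorem IsLongBourbaki.exists_isConstruction {t : ℕ} (ht : t + 3 ≤ n) {c d : ℤ} {p q : ℕ}
    {a : Fin p → ℤ} {b : Fin q → ℤ} {I : Ideal (Poly k n)}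
    {f : (Fin p → Poly k n) →ₗ[Poly k n] (Fin q → Poly k n)}
    {g : (Fin q → Poly k n) →ₗ[Poly k n] Approx k n t} {φ : Approx k n t →ₗ[Poly k n] I}
    (h : IsLongBourbaki t c d a b I f g φ) (hg : ∀ i, g (Pi.single i 1) ≠ 0) :
    ∃ (β : Fin q → Cover k n t) (ψ : Cover k n t →ₗ[Poly k n] Poly k n),
      IsConstruction t c d a b β ψ ∧ I = LinearMap.range ψ := by
  have hlift : ∀ i, ∃ w ∈ coverGrading k n t d (b i), coverMap k n t w = g (Pi.single i 1) :=
    fun i => exists_coverMap_eq ht (by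
      have := h.graded_g _ _ (single_mem_freeGrading b i)
      rwa [add_zero] at this)
  choose β hβ hβg using hlift
  have hg' : ∀ v, coverMap k n t (betaMap β v) = g v := by
    have : coverMap k n t ∘ₗ betaMap β = g :=
      LinearMap.pi_ext' fun i => LinearMap.ext_ring (by simp [betaMap_single, hβg])
    exact fun v => LinearMap.congr_fun this v
  let ψ : Cover k n t →ₗ[Poly k n] Poly k n := I.subtype ∘ₗ φ ∘ₗ coverMap k n t
  have hψ : ∀ x, ψ x = (φ (coverMap k n t x) : Poly k n) := fun x => rfl
  have hψ0 : ∀ x ∈ coverSyz k n t, ψ x = 0 := fun x hx => by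
    rw [← ker_coverMap ht, LinearMap.mem_ker] at hx
    rw [hψ, hx, map_zero]
    rfl
  refine ⟨β, ψ, ⟨hβ, fun i hi => ?_, ?_, ?_, ?_, ?_, f, h.graded_f, h.injective_f, ?_, ?_⟩, ?_⟩
  · rw [← ker_coverMap ht, LinearMap.mem_ker, hβg] at hi
    exact hg i hi
  · refine ⟨ψ ∘ₗ LinearMap.inl _ _ _, mem_spanA (by omega) _ fun w => ?_,
      ψ ∘ₗ LinearMap.inr _ _ _, mem_spanB (by omega) _ fun w => ?_,
      (LinearMap.coprod_comp_inl_inr ψ).symm⟩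
    · exact hψ0 _ ⟨⟨w, rfl⟩, zero_mem _⟩
    · exact hψ0 _ ⟨zero_mem _, ⟨w, rfl⟩⟩
  · intro m v hv
    have h1 := h.graded_φ _ _ (coverMap_mem_approxGrading ht hv)
    change ψ v ∈ polyGrading k n (c + (m + 0)) at h1
    change ψ v ∈ polyGrading k n (-(n : ℤ) + (m + (n + c)))
    rwa [show -(n : ℤ) + (m + (n + c)) = c + (m + 0) by ring]
  · refine le_antisymm (fun x hx => ?_) (sup_le ?_ hψ0)
    · have hx' : φ (coverMap k n t x) = 0 := Subtype.ext hx
      obtain ⟨v, hv⟩ := (h.exact_gφ _).1 hx'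
      rw [← hg'] at hv
      refine Submodule.mem_sup.2 ⟨betaMap β v, ?_, x - betaMap β v, ?_, by abel⟩
      · rw [← range_betaMap]
        exact ⟨v, rfl⟩
      · rw [← ker_coverMap ht, LinearMap.mem_ker, map_sub, hv, sub_self]
    · rw [← range_betaMap]
      rintro _ ⟨v, rfl⟩
      rw [LinearMap.mem_ker, hψ, hg', h.exact_gφ.apply_apply_eq_zero]
      rfl
  · exact rank_relation ht (h.ideal_ne_bot ht) h.injective_f h.exact_fg h.exact_gφ
      h.surjective_φ
  -- $\operatorname{Im} f=\operatorname{Ker} g$ is the full preimage of $E_{t+2}\oplus E_n(d)$ under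
  -- $\beta$.
  · rw [LinearMap.range_comp, ← LinearMap.exact_iff.1 h.exact_fg, ← range_betaMap,
      ← ker_coverMap ht]
    ext x
    constructor
    · rintro ⟨v, hv, rfl⟩
      exact ⟨⟨v, rfl⟩, (hg' v).trans hv⟩
    · rintro ⟨⟨v, rfl⟩, hv⟩
      refine ⟨v, ?_, rfl⟩
      rw [SetLike.mem_coe, LinearMap.mem_ker, hg'] at hv
      exact hv
  · refine le_antisymm ?_ fun v hv => ?_
    · rintro _ ⟨u, hu, rfl⟩
      exact hu
    · obtain ⟨u, rfl⟩ := (h.exact_fg v).1 (by rw [← hg', LinearMap.mem_ker.1 hv, map_zero])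
      exact ⟨u, hv, rfl⟩
  · have h2 : Function.Surjective (φ ∘ₗ coverMap k n t) :=
      h.surjective_φ.comp (coverMap_surjective t)
    change I = LinearMap.range (I.subtype ∘ₗ (φ ∘ₗ coverMap k n t))
    rw [LinearMap.range_comp_of_range_eq_top _ (LinearMap.range_eq_top.2 h2),
      Submodule.range_subtype]

theorem isHomogeneousElem_of_mem_polyGrading {m : ℤ} {u : Poly k n}
    (hu : u ∈ polyGrading k n m) :
    SetLike.IsHomogeneousElem (homogeneousSubmodule (Fin n) k) u := by
  rw [polyGrading] at hu
  split_ifs at hu with hm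
  · exact ⟨_, hu⟩
  · rw [Submodule.mem_bot] at hu
    rw [hu]
    exact ⟨0, zero_mem _⟩

/-- The image is generated by the images of the basis elements, which are homogeneous. -/
theorem isGradedIdeal_range {t : ℕ} {d e : ℤ} {ψ : Cover k n t →ₗ[Poly k n] Poly k n}
    (hψ : IsHomogeneousHom (coverGrading k n t d) (polyGrading k n) e ψ) :
    IsGradedIdeal (LinearMap.range ψ) := by
  let s : Set (Poly k n) := {y | ∃ m, ∃ x ∈ coverGrading k n t d m, ψ x = y}
  have hs : LinearMap.range ψ = Ideal.span s := by
    refine le_antisymm ?_ (Submodule.span_le.2 ?_)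
    · rintro _ ⟨⟨u, v⟩, rfl⟩
      have h1 : ψ (u, v) = (ψ ∘ₗ LinearMap.inl _ _ _) u + (ψ ∘ₗ LinearMap.inr _ _ _) v := by
        simp [← map_add]
      rw [h1, LinearMap.pi_apply_eq_sum_univ (ψ ∘ₗ LinearMap.inl _ _ _) u,
        LinearMap.pi_apply_eq_sum_univ (ψ ∘ₗ LinearMap.inr _ _ _) v]
      refine add_mem (sum_mem fun J _ => ?_) (sum_mem fun J _ => ?_)
      · refine Submodule.smul_mem _ _ (Submodule.subset_span ⟨((t + 1 : ℕ) : ℤ), _, ?_, rfl⟩)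
        rw [show (fun j => if J = j then (1 : Poly k n) else 0) = Pi.single J 1 by
          funext j; simp [Pi.single_apply, eq_comm]]
        exact ⟨single_mem_freeGrading _ J, zero_mem _⟩
      -- Because of the twist, the basis of $K_{n-1}(d)$ lies in degree $n-1-d$.
      · refine Submodule.smul_mem _ _ (Submodule.subset_span ⟨((n - 1 : ℕ) : ℤ) - d, _, ?_, rfl⟩)
        rw [show (fun j => if J = j then (1 : Poly k n) else 0) = Pi.single J 1 by
          funext j; simp [Pi.single_apply, eq_comm]]
        refine ⟨zero_mem _, ?_⟩
        change Pi.single J 1 ∈ freeGrading _ (d + (((n - 1 : ℕ) : ℤ) - d))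
        rw [add_sub_cancel]
        exact single_mem_freeGrading (fun _ => ((n - 1 : ℕ) : ℤ)) J
    · rintro _ ⟨m, x, -, rfl⟩
      exact ⟨x, rfl⟩
  rw [hs]
  let := MvPolynomial.gradedAlgebra (σ := Fin n) (R := k)
  refine Ideal.homogeneous_span _ _ ?_
  rintro _ ⟨m, x, hx, rfl⟩
  exact isHomogeneousElem_of_mem_polyGrading (hψ m x hx)

/-- The data of the construction yield a long Bourbaki sequence. -/
theorem IsConstruction.exists_isLongBourbaki {t : ℕ} (ht : t + 3 ≤ n) {c d : ℤ} {p q : ℕ}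
    {a : Fin p → ℤ} {b : Fin q → ℤ} {β : Fin q → Cover k n t}
    {ψ : Cover k n t →ₗ[Poly k n] Poly k n} (h : IsConstruction t c d a b β ψ) :
    ∃ (f : (Fin p → Poly k n) →ₗ[Poly k n] (Fin q → Poly k n))
      (g : (Fin q → Poly k n) →ₗ[Poly k n] Approx k n t)
      (φ : Approx k n t →ₗ[Poly k n] (LinearMap.range ψ : Ideal (Poly k n))),
      IsLongBourbaki t c d a b (LinearMap.range ψ) f g φ ∧ ∀ i, g (Pi.single i 1) ≠ 0 := by
  obtain ⟨f, hf, hfi, hfr, hfk⟩ := h.diagram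
  have hgr : IsHomogeneousHom (coverGrading k n t d) (polyGrading k n) c ψ := by
    intro m v hv
    have := h.graded_φ m v hv
    change ψ v ∈ polyGrading k n (-(n : ℤ) + (m + (n + c))) at this
    rwa [show -(n : ℤ) + (m + (n + c)) = m + c by ring] at this
  have hle : LinearMap.ker (coverMap k n t) ≤ LinearMap.ker ψ.rangeRestrict := by
    rw [LinearMap.ker_rangeRestrict, h.ker_φ, ker_coverMap ht]
    exact le_sup_right
  let e := (coverMap k n t).quotKerEquivOfSurjective (coverMap_surjective t)
  let φ : Approx k n t →ₗ[Poly k n] LinearMap.range ψ :=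
    (LinearMap.ker (coverMap k n t)).liftQ ψ.rangeRestrict hle ∘ₗ e.symm.toLinearMap
  have hφ : ∀ x, (φ (coverMap k n t x) : Poly k n) = ψ x := by
    intro x
    have : e.symm (coverMap k n t x) = Submodule.Quotient.mk x := by
      rw [LinearEquiv.symm_apply_eq]
      rfl
    simp only [φ, LinearMap.comp_apply, LinearEquiv.coe_coe, this, Submodule.liftQ_apply]
    rfl
  refine ⟨f, coverMap k n t ∘ₗ betaMap β, φ, ⟨isGradedIdeal_range hgr, hf, ?_, ?_, hfi, ?_, ?_,
    ?_⟩, fun i hi => ?_⟩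
  · intro m v hv
    exact coverMap_mem_approxGrading ht (isHomogeneousHom_betaMap h.homogeneous_β m v hv)
  · intro m v hv
    obtain ⟨w, hw, rfl⟩ := exists_coverMap_eq ht hv
    change (φ (coverMap k n t w) : Poly k n) ∈ polyGrading k n (c + (m + 0))
    rw [hφ, add_zero, add_comm]
    exact hgr m w hw
  · intro v
    rw [LinearMap.comp_apply, ← LinearMap.mem_ker, ker_coverMap ht]
    constructor
    · intro hv
      have hv' : betaMap β v ∈ LinearMap.range (betaMap β ∘ₗ f) := by
        rw [hfr, ← range_betaMap]
        exact ⟨⟨v, rfl⟩, hv⟩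
      obtain ⟨u, hu⟩ := hv'
      -- $v$ and $f(u)$ have the same image under $\beta$, and the diagram gives
      -- $\operatorname{Ker}\beta\subset\operatorname{Im} f$, so $v\in\operatorname{Im} f$.
      have hk : v - f u ∈ LinearMap.ker (betaMap β) := by
        rw [LinearMap.mem_ker, map_sub, sub_eq_zero]
        exact hu.symm
      rw [← hfk] at hk
      obtain ⟨u', -, hu'⟩ := hk
      exact ⟨u' + u, by rw [map_add, hu', sub_add_cancel]⟩
    · rintro ⟨u, rfl⟩
      have : betaMap β (f u) ∈ LinearMap.range (betaMap β ∘ₗ f) := ⟨u, rfl⟩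
      rw [hfr] at this
      exact this.2
  · intro y
    obtain ⟨x, rfl⟩ := coverMap_surjective t y
    have h0 : φ (coverMap k n t x) = 0 ↔ x ∈ LinearMap.ker ψ := by
      rw [LinearMap.mem_ker, ← hφ, Subtype.ext_iff]
      rfl
    rw [h0, h.ker_φ]
    constructor
    · intro hx
      obtain ⟨y, hy, z, hz, rfl⟩ := Submodule.mem_sup.1 hx
      rw [← range_betaMap] at hy
      obtain ⟨v, rfl⟩ := hy
      rw [← ker_coverMap ht, LinearMap.mem_ker] at hz
      exact ⟨v, by rw [map_add, hz, add_zero]; rfl⟩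
    · rintro ⟨v, hv⟩
      refine Submodule.mem_sup.2 ⟨betaMap β v, ?_, x - betaMap β v, ?_, by abel⟩
      · rw [← range_betaMap]
        exact ⟨v, rfl⟩
      · rw [← ker_coverMap ht, LinearMap.mem_ker, map_sub, sub_eq_zero]
        exact hv.symm
  · rintro ⟨_, x, rfl⟩
    exact ⟨coverMap k n t x, Subtype.ext (hφ x)⟩
  · rw [LinearMap.comp_apply, betaMap_single, ← LinearMap.mem_ker, ker_coverMap ht] at hi
    exact h.not_mem_β i hi

end Construction

/-! ### Cancelling basis elements in the kernel of $g$ -/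

section Reduction

variable {k : Type*} [Field k] {n : ℕ}

/-- A nonzero constant term forces degree $0$, so $u$ is a nonzero constant. -/
theorem isUnit_of_mem_polyGrading {m : ℤ} {u : Poly k n} (hu : u ∈ polyGrading k n m)
    (h : constantCoeff u ≠ 0) : IsUnit u := by
  have h0 : polyComponent 0 u = C (coeff 0 u) := by
    rw [polyComponent, if_pos le_rfl, Int.toNat_zero, homogeneousComponent_zero]
  rw [polyComponent_of_mem hu] at h0
  split_ifs at h0
  · rw [h0]
    exact (isUnit_iff_ne_zero.2 h).map C
  · exact absurd ((C_eq_zero.1 h0.symm)) h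

section InsertZero

variable {R : Type*} [CommRing R] {q : ℕ}

theorem extendByZero_succAbove (i : Fin (q + 1)) (w : Fin q → R) (l : Fin q) :
    Function.ExtendByZero.linearMap R i.succAbove w (i.succAbove l) = w l :=
  Fin.succAbove_right_injective.extend_apply _ _ _

theorem extendByZero_self (i : Fin (q + 1)) (w : Fin q → R) :
    Function.ExtendByZero.linearMap R i.succAbove w i = 0 :=
  Function.extend_apply' _ _ _ fun ⟨l, hl⟩ => Fin.succAbove_ne i l hl

theorem extendByZero_comp_succAbove (i : Fin (q + 1)) (v : Fin (q + 1) → R) :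
    Function.ExtendByZero.linearMap R i.succAbove (v ∘ i.succAbove) = v - v i • Pi.single i 1 := by
  funext l
  rcases Fin.eq_self_or_eq_succAbove i l with rfl | ⟨l, rfl⟩
  · rw [extendByZero_self]
    simp
  · rw [extendByZero_succAbove]
    simp [Fin.succAbove_ne]

end InsertZero

theorem isHomogeneousHom_extendByZero {q : ℕ} (b : Fin (q + 1) → ℤ) (i : Fin (q + 1)) :
    IsHomogeneousHom (k := k) (freeGrading (b ∘ i.succAbove)) (freeGrading b) 0
      (Function.ExtendByZero.linearMap (Poly k n) i.succAbove) := by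
  intro m v hv
  rw [add_zero, mem_freeGrading]
  intro l
  rcases Fin.eq_self_or_eq_succAbove i l with rfl | ⟨l, rfl⟩
  · rw [extendByZero_self]
    exact zero_mem _
  · rw [extendByZero_succAbove]
    exact mem_freeGrading.1 hv l

/-- A basis element which is mapped to zero can be split off from a long Bourbaki sequence. -/
theorem IsLongBourbaki.exists_of_apply_single_eq_zero {t : ℕ} {c d : ℤ} {p q : ℕ} {a : Fin p → ℤ}
    {b : Fin (q + 1) → ℤ} {I : Ideal (Poly k n)}
    {f : (Fin p → Poly k n) →ₗ[Poly k n] (Fin (q + 1) → Poly k n)}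
    {g : (Fin (q + 1) → Poly k n) →ₗ[Poly k n] Approx k n t} {φ : Approx k n t →ₗ[Poly k n] I}
    (h : IsLongBourbaki t c d a b I f g φ) {i : Fin (q + 1)} (hi : g (Pi.single i 1) = 0) :
    ∃ (p' : ℕ) (a' : Fin p' → ℤ) (b' : Fin q → ℤ)
      (f' : (Fin p' → Poly k n) →ₗ[Poly k n] (Fin q → Poly k n))
      (g' : (Fin q → Poly k n) →ₗ[Poly k n] Approx k n t),
      IsLongBourbaki t c d a' b' I f' g' φ := by
  obtain ⟨u, hu, hui⟩ : ∃ u ∈ freeGrading (k := k) a (b i), f u = Pi.single i 1 := by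
    obtain ⟨u, hu⟩ := (h.exact_fg _).1 hi
    refine ⟨_, freeComponent_mem a (b i) u, ?_⟩
    rw [map_freeComponent h.graded_f, hu, freeComponent_self (single_mem_freeGrading b i)]
  -- The $i$-th coordinate of $f(u)=\sum_j u_jf(e_j)$ is $1$, so some $u_j$ has a nonzero constant
  -- term; being homogeneous, it is a unit.
  obtain ⟨j, hj⟩ : ∃ j, IsUnit (u j) := by
    have h1 : f u i = 1 := by rw [hui, Pi.single_eq_same]
    rw [LinearMap.pi_apply_eq_sum_univ f u, Finset.sum_apply] at h1
    have h2 := congrArg constantCoeff h1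
    rw [map_sum, map_one] at h2
    obtain ⟨j, -, hj⟩ := Finset.exists_ne_zero_of_sum_ne_zero (h2 ▸ one_ne_zero)
    rw [Pi.smul_apply, smul_eq_mul, map_mul] at hj
    exact ⟨j, isUnit_of_mem_polyGrading (mem_freeGrading.1 hu j) (left_ne_zero_of_mul hj)⟩
  obtain ⟨p, rfl⟩ : ∃ p', p = p' + 1 := ⟨p - 1, by have := j.2; omega⟩
  let E := Function.ExtendByZero.linearMap (Poly k n) i.succAbove
  let F := Function.ExtendByZero.linearMap (Poly k n) j.succAbove
  have hgE : ∀ v, g (E (v ∘ i.succAbove)) = g v := fun v => by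
    rw [extendByZero_comp_succAbove, map_sub, map_smul, hi, smul_zero, sub_zero]
  refine ⟨p, a ∘ j.succAbove, b ∘ i.succAbove,
    LinearMap.funLeft (Poly k n) (Poly k n) i.succAbove ∘ₗ f ∘ₗ F, g ∘ₗ E,
    h.graded_ideal, ?_, ?_, h.graded_φ, ?_, ?_, ?_, h.surjective_φ⟩
  · intro m v hv
    have h1 := h.graded_f _ _ (isHomogeneousHom_extendByZero a j m v hv)
    rw [add_zero, mem_freeGrading] at h1
    exact mem_freeGrading.2 fun l => h1 (i.succAbove l)
  · intro m v hv
    have h1 := h.graded_g _ _ (isHomogeneousHom_extendByZero b i m v hv)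
    rwa [add_zero] at h1
  · rw [injective_iff_map_eq_zero]
    intro w hw
    -- If all coordinates but the $i$-th vanish, $f(Fw)$ is a multiple of $f(u)$, hence $Fw$ is a
    -- multiple of $u$. Its $j$-th coordinate is $0$ while $u_j$ is a unit.
    have h1 : f (F w) = (f (F w) i) • Pi.single i 1 := by
      have h2 := extendByZero_comp_succAbove i (f (F w))
      have h3 : f (F w) ∘ i.succAbove = 0 := hw
      rw [h3, map_zero] at h2
      exact (sub_eq_zero.1 h2.symm)
    rw [← hui, ← map_smul] at h1
    have h2 := h.injective_f h1
    have h3 := congrFun h2 j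
    rw [extendByZero_self, Pi.smul_apply, smul_eq_mul, eq_comm, hj.mul_left_eq_zero] at h3
    rw [h3, zero_smul] at h2
    funext l
    rw [← extendByZero_succAbove j w l]
    exact congrFun h2 _
  · intro v
    constructor
    · intro hv
      obtain ⟨y, hy⟩ := (h.exact_fg (E v)).1 hv
      -- With $z=u_j^{-1}$, subtracting $y_jz\,u$ from $y$ clears its $j$-th coordinate and alters
      -- $f(y)$ only in the discarded coordinate $i$.
      obtain ⟨z, hz⟩ := hj.exists_right_inv
      have hr : y j * z * u j = y j := by linear_combination y j * hz
      generalize y j * z = r at hr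
      refine ⟨(y - r • u) ∘ j.succAbove, funext fun l => ?_⟩
      have h1 : F ((y - r • u) ∘ j.succAbove) = y - r • u := by
        rw [extendByZero_comp_succAbove]
        simp [hr]
      change f (F ((y - r • u) ∘ j.succAbove)) (i.succAbove l) = v l
      rw [h1, map_sub, map_smul, hui, hy, Pi.sub_apply, extendByZero_succAbove]
      simp [Fin.succAbove_ne]
    · rintro ⟨w, rfl⟩
      exact (hgE (f (F w))).trans (h.exact_fg.apply_apply_eq_zero _)
  · intro y
    rw [h.exact_gφ y]
    constructor
    · rintro ⟨v, rfl⟩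
      exact ⟨v ∘ i.succAbove, hgE v⟩
    · rintro ⟨v, rfl⟩
      exact ⟨E v, rfl⟩

/-- Every long Bourbaki sequence can be replaced by one in which no basis element is mapped to
zero. -/
theorem IsLongBourbaki.exists_apply_single_ne_zero {t : ℕ} {c d : ℤ} {p q : ℕ} {a : Fin p → ℤ}
    {b : Fin q → ℤ} {I : Ideal (Poly k n)}
    {f : (Fin p → Poly k n) →ₗ[Poly k n] (Fin q → Poly k n)}
    {g : (Fin q → Poly k n) →ₗ[Poly k n] Approx k n t} {φ : Approx k n t →ₗ[Poly k n] I}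
    (h : IsLongBourbaki t c d a b I f g φ) :
    ∃ (p' q' : ℕ) (a' : Fin p' → ℤ) (b' : Fin q' → ℤ)
      (f' : (Fin p' → Poly k n) →ₗ[Poly k n] (Fin q' → Poly k n))
      (g' : (Fin q' → Poly k n) →ₗ[Poly k n] Approx k n t),
      IsLongBourbaki t c d a' b' I f' g' φ ∧ ∀ i, g' (Pi.single i 1) ≠ 0 := by
  induction q generalizing p with
  | zero => exact ⟨p, 0, a, b, f, g, h, fun i => i.elim0⟩
  | succ q ih =>
    by_cases hg : ∀ i, g (Pi.single i 1) ≠ 0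
    · exact ⟨p, q + 1, a, b, f, g, h, hg⟩
    · push Not at hg
      obtain ⟨i, hi⟩ := hg
      obtain ⟨p', a', b', f', g', h'⟩ := h.exists_of_apply_single_eq_zero hi
      exact ih h'

end Reduction

end LongBourbaki

open LongBourbaki in
theorem theorem2p2 {k : Type*} [Field k] (n t : ℕ) (ht : t + 3 ≤ n) (c d : ℤ)
    (I : Ideal (Poly k n)) :
    -- existence of a sequence for `I`, with some `p`, `q`, `a_i`, `b_i`
    ((∃ (p q : ℕ) (a : Fin p → ℤ) (b : Fin q → ℤ)
        (f : (Fin p → Poly k n) →ₗ[Poly k n] (Fin q → Poly k n))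
        (g : (Fin q → Poly k n) →ₗ[Poly k n] Approx k n t)
        (φ : Approx k n t →ₗ[Poly k n] I),
        IsLongBourbaki t c d a b I f g φ) ↔
      ∃ (p q : ℕ) (a : Fin p → ℤ) (b : Fin q → ℤ)
        (β : Fin q → Cover k n t) (φ : Cover k n t →ₗ[Poly k n] Poly k n),
        IsConstruction t c d a b β φ ∧ I = LinearMap.range φ) ∧
    -- the same with prescribed `p`, `q`, `a_i`, `b_i`
    ∀ (p q : ℕ) (a : Fin p → ℤ) (b : Fin q → ℤ),
      (∃ (f : (Fin p → Poly k n) →ₗ[Poly k n] (Fin q → Poly k n))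
        (g : (Fin q → Poly k n) →ₗ[Poly k n] Approx k n t)
        (φ : Approx k n t →ₗ[Poly k n] I),
        IsLongBourbaki t c d a b I f g φ ∧ ∀ i, g (Pi.single i 1) ≠ 0) ↔
      ∃ (β : Fin q → Cover k n t) (φ : Cover k n t →ₗ[Poly k n] Poly k n),
        IsConstruction t c d a b β φ ∧ I = LinearMap.range φ := by
  have hseq : ∀ {p q : ℕ} {a : Fin p → ℤ} {b : Fin q → ℤ}
      (β : Fin q → Cover k n t) (φ : Cover k n t →ₗ[Poly k n] Poly k n),
      IsConstruction t c d a b β φ ∧ I = LinearMap.range φ →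
      ∃ (f : (Fin p → Poly k n) →ₗ[Poly k n] (Fin q → Poly k n))
        (g : (Fin q → Poly k n) →ₗ[Poly k n] Approx k n t)
        (φ : Approx k n t →ₗ[Poly k n] I),
        IsLongBourbaki t c d a b I f g φ ∧ ∀ i, g (Pi.single i 1) ≠ 0 := by
    rintro p q a b β φ ⟨h, rfl⟩
    exact h.exists_isLongBourbaki ht
  refine ⟨⟨?_, ?_⟩, fun p q a b => ⟨?_, ?_⟩⟩
  · rintro ⟨p, q, a, b, f, g, φ, h⟩
    obtain ⟨p', q', a', b', f', g', h', hg⟩ := h.exists_apply_single_ne_zero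
    exact ⟨p', q', a', b', h'.exists_isConstruction ht hg⟩
  · rintro ⟨p, q, a, b, β, φ, h⟩
    obtain ⟨f, g, φ, h', -⟩ := hseq β φ h
    exact ⟨p, q, a, b, f, g, φ, h'⟩
  · rintro ⟨f, g, φ, h, hg⟩
    exact h.exists_isConstruction ht hg
  · rintro ⟨β, φ, h⟩
    exact hseq β φ h
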